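/- Let $a,b,c,d,e\in\mathbb{R}$ with $ac\neq 0$, put $A(z)=az+b$, $B(z)=cz^2+dz+e$, and let $\{W_n(z)\}_{n\ge 0}$ be a sequence of complex polynomials with $$W_n(z)=A(z)W_{n-1}(z)+B(z)W_{n-2}(z)\qquad(n\ge 2).$$ Assume that the sequence is \emph{general}, that is: $W_1^2-AW_0W_1-BW_0^2$ is not identically zero; $A$ and $B$ have no common zero in $\mathbb{C}$; and $W_0$ and $W_1$ have no common zero in $\mathbb{C}$. A number $z^*\in\mathbb{C}$ is a \emph{limit of zeros} of the sequence if for all sufficiently large $n$ there is a zero $z_n$ of $W_n$ such that $z_n\to z^*$. Let $\clubsuit$ be the set of non-isolated limits of zeros, i.e. the limits of zeros that are accumulation points of the set of all limits of zeros. Let $\sqrt{\cdot}$ be the principal square root, $x_A=-b/a$, $\Delta_\Delta=16\bigl(d^2-4ce-a^2B(x_A)\bigr)$, and $$x_\Delta^{\pm}=\frac{-ab-2d}{a^2+4c}\pm\frac{\sqrt{\Delta_\Delta}}{2|a^2+4c|}\quad\text{if }a^2+4c\ne 0,\qquad x_\Delta^{\pm}=-\frac{b^2+4e}{2ab+4d}\quad\text{if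 }a^2+4c=0\text{ and }2ab+4d\neq 0.$$ By a \emph{real shape} we mean one of the following: the real line $\mathbb{R}$, a bounded closed interval of positive length in $\mathbb{R}$, a closed ray in $\mathbb{R}$, or the union of two disjoint closed rays in $\mathbb{R}$. Then $\clubsuit$ is one of the following sets: 1. a closed circular arc with ends $x_\Delta^-$ and $x_\Delta^+$, both of them non-real, or (the degenerate form) the vertical line segment with these non-real ends; 2. the union of $\mathbb{R}$ and a closed circular arc with ends $x_\Delta^-$ and $x_\Delta^+$, both of them non-real, or (the degenerate form) the union of $\mathbb{R}$ and two disjoint closed vertical rays with these non-real ends $x_\Delta^-$ and $x_\Delta^+$, respectively; 3. a real shape; 4. the union of a vertical line and a real shape that are disjoint from each other; 5. the union of a circle (of positive radius) and a real shape that meet in exactly one point; 6. a circle (of positive radius), or (the degenerate form) a vertical line. -/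

import Mathlib

open Polynomial Filter Topology

noncomputable section

namespace RootDistribution

/-- The linear coefficient polynomial `A(z) = a z + b`. -/
def polyA (a b : ℝ) : ℂ[X] := C (a : ℂ) * X + C (b : ℂ)

/-- The quadratic coefficient polynomial `B(z) = c z ^ 2 + d z + e`. -/
def polyB (c d e : ℝ) : ℂ[X] := C (c : ℂ) * X ^ 2 + C (d : ℂ) * X + C (e : ℂ)

/-- The recurrence `W_n = A W_{n-1} + B W_{n-2}` for `n ≥ 2`. -/
def SatisfiesRec (A B : ℂ[X]) (W : ℕ → ℂ[X]) : Prop :=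
  ∀ n : ℕ, W (n + 2) = A * W (n + 1) + B * W n

/-- A sequence satisfying the recurrence with coefficients `A`, `B` is general. -/
structure IsGeneral (A B : ℂ[X]) (W : ℕ → ℂ[X]) : Prop where
  /-- `W_1 ^ 2 - A W_0 W_1 - B W_0 ^ 2` is not identically zero. -/
  char_ne_zero : W 1 ^ 2 - A * W 0 * W 1 - B * W 0 ^ 2 ≠ 0
  /-- `A` and `B` do not share a zero. -/
  no_common_zero_coeff : ¬ ∃ z : ℂ, A.eval z = 0 ∧ B.eval z = 0
  /-- `W_0` and `W_1` do not share a zero. -/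
  no_common_zero_init : ¬ ∃ z : ℂ, (W 0).eval z = 0 ∧ (W 1).eval z = 0

/-- `z` is a limit of zeros of the sequence `W`: for all large `n` there is a zero `u n` of `W n`,
and `u n` tends to `z`. (Finitely many members, such as a constant `W 0`, may have no zero.) -/
def IsLimitOfZeros (W : ℕ → ℂ[X]) (z : ℂ) : Prop :=
  ∃ u : ℕ → ℂ, (∀ᶠ n in atTop, (W n).eval (u n) = 0) ∧ Tendsto u atTop (𝓝 z)

/-- The set of all limits of zeros. -/
def limitsOfZeros (W : ℕ → ℂ[X]) : Set ℂ := {z | IsLimitOfZeros W z}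

/-- The set of non-isolated limits of zeros: the limits of zeros that are accumulation points of
the set of all limits of zeros. -/
def nonIsolatedLimits (W : ℕ → ℂ[X]) : Set ℂ :=
  {z | z ∈ limitsOfZeros W ∧ AccPt z (𝓟 (limitsOfZeros W))}

/-- `16 (Δ_B - a ^ 2 B(x_A))` with `Δ_B = d ^ 2 - 4 c e` and `x_A = - b / a`. -/
def discDelta (a b c d e : ℝ) : ℝ :=
  16 * ((d ^ 2 - 4 * c * e) - a ^ 2 * (c * (-b / a) ^ 2 + d * (-b / a) + e))

/-- The point `x_Δ^+`. `Complex.sqrt` is the principal square root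
`√(r e^{iθ}) = √r e^{iθ/2}` for `θ ∈ (-π, π]`. -/
def xDeltaPlus (a b c d e : ℝ) : ℂ :=
  if a ^ 2 + 4 * c ≠ 0 then
    (((-(a * b) - 2 * d) / (a ^ 2 + 4 * c) : ℝ) : ℂ)
      + Complex.sqrt (discDelta a b c d e : ℂ) / ((2 * |a ^ 2 + 4 * c| : ℝ) : ℂ)
  else ((-((b ^ 2 + 4 * e) / (2 * a * b + 4 * d)) : ℝ) : ℂ)

/-- The point `x_Δ^-`. -/
def xDeltaMinus (a b c d e : ℝ) : ℂ :=
  if a ^ 2 + 4 * c ≠ 0 then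
    (((-(a * b) - 2 * d) / (a ^ 2 + 4 * c) : ℝ) : ℂ)
      - Complex.sqrt (discDelta a b c d e : ℂ) / ((2 * |a ^ 2 + 4 * c| : ℝ) : ℂ)
  else ((-((b ^ 2 + 4 * e) / (2 * a * b + 4 * d)) : ℝ) : ℂ)

/-- The real line in the complex plane. -/
def realLine : Set ℂ := {z | z.im = 0}

/-- The vertical line `Re z = x`. -/
def verticalLine (x : ℝ) : Set ℂ := {z | z.re = x}

/-- `S` is a circle of positive radius. -/
def IsCircle (S : Set ℂ) : Prop := ∃ (o : ℂ) (R : ℝ), 0 < R ∧ S = Metric.sphere o R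

/-- `S` is a proper closed circular arc with (distinct) ends `p` and `q`, in either orientation. -/
def IsArc (S : Set ℂ) (p q : ℂ) : Prop :=
  ∃ (o : ℂ) (R θ₁ θ₂ : ℝ), 0 < R ∧ θ₁ < θ₂ ∧ θ₂ < θ₁ + 2 * Real.pi ∧
    S = circleMap o R '' Set.Icc θ₁ θ₂ ∧
    ((circleMap o R θ₁ = p ∧ circleMap o R θ₂ = q) ∨
      (circleMap o R θ₁ = q ∧ circleMap o R θ₂ = p))

/-- `S` is the vertical line segment with distinct ends `p` and `q`. -/
def IsVerticalSegment (S : Set ℂ) (p q : ℂ) : Prop :=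
  p.re = q.re ∧ p ≠ q ∧ S = segment ℝ p q

/-- `S` is a closed vertical ray (upward or downward) with end `p`. -/
def IsVerticalRay (S : Set ℂ) (p : ℂ) : Prop :=
  S = {z | z.re = p.re ∧ p.im ≤ z.im} ∨ S = {z | z.re = p.re ∧ z.im ≤ p.im}

/-- `S` is the union of two disjoint vertical rays with ends `p` and `q`, respectively. -/
def IsTwoVerticalRays (S : Set ℂ) (p q : ℂ) : Prop :=
  ∃ R₁ R₂ : Set ℂ, IsVerticalRay R₁ p ∧ IsVerticalRay R₂ q ∧ Disjoint R₁ R₂ ∧ S = R₁ ∪ R₂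

/-- `S` is a closed ray on the real line. -/
def IsRealRay (S : Set ℂ) : Prop :=
  ∃ s : ℝ, S = Complex.ofReal '' Set.Ici s ∨ S = Complex.ofReal '' Set.Iic s

/-- `S` is the real line, or a bounded closed real interval of positive length, or a real ray, or
the union of two disjoint real rays. -/
def IsRealShape (S : Set ℂ) : Prop :=
  S = realLine ∨
  (∃ s t : ℝ, s < t ∧ S = Complex.ofReal '' Set.Icc s t) ∨
  IsRealRay S ∨
  (∃ R₁ R₂ : Set ℂ, IsRealRay R₁ ∧ IsRealRay R₂ ∧ Disjoint R₁ R₂ ∧ S = R₁ ∪ R₂)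

end RootDistribution

end

noncomputable section

namespace RootDistribution

/-! The roots `x`, `y` of `t^2 = A t + B` have `x + y = A` and `x y = -B`, and Binet's formula
expresses `W n` through `x^n` and `y^n`. Where one root dominates, a limit of zeros must kill its
coefficient, hence be one of the finitely many zeros of `W_1^2 - A W_0 W_1 - B W_0^2 = (W_1 - x
W_0)(W_1 - y W_0)`. Where `|x| = |y|`, the equation `(x/y)^n = Q/P` has solutions arbitrarily close
by for all large `n`. Since `-A^2/B = 2 + x/y + y/x`, equal moduli mean `A^2 + s B = 0` with `s ∈
[0,4]`, so the non-isolated limits form `equimodularSet` (`nonIsolatedLimits_eq_equimodularSet`).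

This set becomes simple after inversion at the zero `x₀` of `A`. Put `p = z - x₀`, `E = B(x₀)`, `m =
-B'(x₀)/(2E)`; then `A^2 + 4B = 4E((1 - m p)^2 - q p^2)`, and with `w = 1/p - m` the condition
reads: `w^2 = T` is real and `E(q - T) ≥ 0`, the point `p = 0` (`w = ∞`) being added. Thus `w` is
real (`z` real) or imaginary (`z` on the circle `Re (1/p) = m` through `x₀`, a vertical line if `m =
0`).

If `E > 0`, then `T ≤ q`: an arc through `x₀` for `q < 0`, the whole circle for `q = 0`, and the
circle with a real piece for `q > 0`. If `E < 0`, then `T ≥ q`: the real line with the complementary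
arc, the real line, or a real piece. The ends `T = q`, that is `s = 4`, are the zeros of `A^2 + 4B`.
-/

/-! ### Limits of zeros form a closed set -/

open Metric in
lemma mem_limitsOfZeros_iff {W : ℕ → ℂ[X]} {z : ℂ} : z ∈ limitsOfZeros W ↔
    ∀ ε > 0, ∀ᶠ n in atTop, ∃ u ∈ ball z ε, (W n).eval u = 0 := by
  constructor
  · rintro ⟨u, hu, hlim⟩ ε hε
    filter_upwards [hu, hlim.eventually (ball_mem_nhds z hε)] with n h1 h2
    exact ⟨u n, h2, h1⟩
  · intro h
    -- Taking a zero nearest to `z` gives one sequence that serves every `ε`; the value is arbitrary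
    -- when `W n` has no zero.
    have key : ∀ n, ∃ u : ℂ, (∃ v, (W n).eval v = 0) →
        (W n).eval u = 0 ∧ infDist z {v | (W n).eval v = 0} = dist z u := by
      intro n
      by_cases hn : ∃ v, (W n).eval v = 0
      · have hcl : IsClosed {v | (W n).eval v = 0} :=
          isClosed_eq (W n).continuous continuous_const
        obtain ⟨u, hu, hd⟩ := hcl.exists_infDist_eq_dist hn z
        exact ⟨u, fun _ => ⟨hu, hd⟩⟩
      · exact ⟨0, fun h => absurd h hn⟩
    choose u hu using key
    refine ⟨u, ?_, ?_⟩
    · filter_upwards [h 1 one_pos] with n hn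
      obtain ⟨v, -, hv⟩ := hn
      exact (hu n ⟨v, hv⟩).1
    · rw [Metric.tendsto_nhds]
      intro ε hε
      filter_upwards [h ε hε] with n hn
      obtain ⟨v, hvb, hv⟩ := hn
      rw [dist_comm, ← (hu n ⟨v, hv⟩).2]
      exact (infDist_le_dist_of_mem (s := {v | (W n).eval v = 0}) hv).trans_lt
        (by rwa [dist_comm])

open Metric in
lemma isClosed_limitsOfZeros (W : ℕ → ℂ[X]) : IsClosed (limitsOfZeros W) := by
  rw [← closure_subset_iff_isClosed]
  intro z hz
  rw [mem_limitsOfZeros_iff]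
  intro ε hε
  obtain ⟨w, hw, hzw⟩ := Metric.mem_closure_iff.1 hz (ε / 2) (half_pos hε)
  filter_upwards [mem_limitsOfZeros_iff.1 hw (ε / 2) (half_pos hε)] with n hn
  obtain ⟨u, hu, h0⟩ := hn
  refine ⟨u, ?_, h0⟩
  rw [mem_ball] at *
  rw [dist_comm] at hzw
  linarith [dist_triangle u w z]

/-! ### Binet's formula and points with a dominant root -/

/-- Binet's formula for a binary recurrence with characteristic roots `x` and `y`. -/
lemma binet {w : ℕ → ℂ} {α β x y : ℂ} (hw : ∀ n, w (n + 2) = α * w (n + 1) + β * w n)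
    (hadd : x + y = α) (hmul : x * y = -β) (n : ℕ) :
    (x - y) * w n = x ^ n * (w 1 - y * w 0) - y ^ n * (w 1 - x * w 0) := by
  have hβ : β = -(x * y) := by rw [hmul]; ring
  subst hadd hβ
  induction n using Nat.twoStepInduction with
  | zero => ring
  | one => ring
  | more n h1 h2 =>
    rw [hw, mul_add, mul_left_comm, mul_left_comm (x - y), h2, h1]
    ring

lemma sqrt_sq (z : ℂ) : Complex.sqrt z ^ 2 = z := by
  simp [Complex.sqrt]

lemma sqrt_re_pos {z : ℂ} (hz : z ∈ Complex.slitPlane) : 0 < (Complex.sqrt z).re := by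
  rw [Complex.sqrt, Complex.cpow_inv_two_re]
  apply Real.sqrt_pos.2
  rcases hz with h | h
  · positivity
  · have := Complex.abs_re_lt_norm.2 h
    linarith [neg_abs_le z.re]

lemma norm_one_sub_lt_norm_one_add {s : ℂ} (hs : 0 < s.re) : ‖1 - s‖ < ‖1 + s‖ := by
  rw [← sq_lt_sq₀ (norm_nonneg _) (norm_nonneg _), ← Complex.normSq_eq_norm_sq,
    ← Complex.normSq_eq_norm_sq, Complex.normSq_apply, Complex.normSq_apply]
  simp
  nlinarith

/-- A limit of zeros at which one characteristic root dominates is a zero of the characteristic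
polynomial. -/
lemma eval_char_eq_zero_of_slitPlane {A B : ℂ[X]} {W : ℕ → ℂ[X]} (hrec : SatisfiesRec A B W)
    {z : ℂ} (hA : A.eval z ≠ 0)
    (hz : (A.eval z ^ 2 + 4 * B.eval z) / A.eval z ^ 2 ∈ Complex.slitPlane)
    (hlim : z ∈ limitsOfZeros W) :
    (W 1 ^ 2 - A * W 0 * W 1 - B * W 0 ^ 2).eval z = 0 := by
  obtain ⟨u, hu0, hu⟩ := hlim
  -- The roots are `A (1 ± √τ) / 2`. Off the cut `√τ` is continuous with positive real part, so the
  -- root with the plus sign dominates.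
  set τ : ℂ → ℂ := fun w => (A.eval w ^ 2 + 4 * B.eval w) / A.eval w ^ 2 with hτ
  have hτc : ContinuousAt τ z := by
    refine ContinuousAt.div ?_ ?_ (pow_ne_zero 2 hA)
    · exact ((A.continuous.pow 2).add (continuous_const.mul B.continuous)).continuousAt
    · exact (A.continuous.pow 2).continuousAt
  set s : ℂ → ℂ := fun w => Complex.sqrt (τ w) with hs
  have hsc : ContinuousAt s z :=
    (Complex.differentiableAt_sqrt hz).continuousAt.comp (f := τ) hτc
  set x : ℂ → ℂ := fun w => A.eval w * (1 + s w) / 2 with hx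
  set y : ℂ → ℂ := fun w => A.eval w * (1 - s w) / 2 with hy
  have hxc : ContinuousAt x z :=
    (A.continuous.continuousAt.mul (continuousAt_const.add hsc)).div_const 2
  have hyc : ContinuousAt y z :=
    (A.continuous.continuousAt.mul (continuousAt_const.sub hsc)).div_const 2
  have hadd (w) : x w + y w = A.eval w := by simp only [hx, hy]; ring
  have hmul (w) (hw : A.eval w ≠ 0) : x w * y w = -B.eval w := by
    have h1 : x w * y w = A.eval w ^ 2 * (1 - s w ^ 2) / 4 := by simp only [hx, hy]; ring
    rw [h1, sqrt_sq]
    simp only [hτ]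
    field_simp
    ring
  have hlt : ‖y z‖ < ‖x z‖ := by
    simp only [hx, hy, norm_div, norm_mul]
    have h1 := norm_one_sub_lt_norm_one_add (sqrt_re_pos hz)
    have h2 : 0 < ‖A.eval z‖ := norm_pos_iff.2 hA
    have h3 : ‖1 - s z‖ < ‖1 + s z‖ := h1
    gcongr
    norm_num
  have hx0 : x z ≠ 0 := norm_pos_iff.1 ((norm_nonneg _).trans_lt hlt)
  have hquot : ContinuousAt (fun w => ‖y w / x w‖) z := (hyc.div hxc hx0).norm
  obtain ⟨ρ, hρ1, hρ2⟩ : ∃ ρ, ‖y z / x z‖ < ρ ∧ ρ < 1 := by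
    apply exists_between
    rw [norm_div, div_lt_one (norm_pos_iff.2 hx0)]
    exact hlt
  have hρ0 : 0 ≤ ρ := (norm_nonneg _).trans hρ1.le
  have hW (k : ℕ) : Tendsto (fun n => (W k).eval (u n)) atTop (𝓝 ((W k).eval z)) :=
    ((W k).continuous.tendsto z).comp hu
  have hP : Tendsto (fun n => (W 1).eval (u n) - y (u n) * (W 0).eval (u n)) atTop
      (𝓝 ((W 1).eval z - y z * (W 0).eval z)) :=
    (hW 1).sub ((hyc.tendsto.comp hu).mul (hW 0))
  have hQ : Tendsto (fun n => (W 1).eval (u n) - x (u n) * (W 0).eval (u n)) atTop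
      (𝓝 ((W 1).eval z - x z * (W 0).eval z)) :=
    (hW 1).sub ((hxc.tendsto.comp hu).mul (hW 0))
  have hP0 : Tendsto (fun n => (W 1).eval (u n) - y (u n) * (W 0).eval (u n)) atTop (𝓝 0) := by
    have hb : Tendsto (fun n => ρ ^ n * ‖(W 1).eval (u n) - x (u n) * (W 0).eval (u n)‖) atTop
        (𝓝 0) := by
      have := (tendsto_pow_atTop_nhds_zero_of_lt_one hρ0 hρ2).mul hQ.norm
      rwa [zero_mul] at this
    refine squeeze_zero_norm' ?_ hb
    filter_upwards [hu0, hu.eventually (hquot.eventually (gt_mem_nhds hρ1)),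
      hu.eventually (hxc.eventually_ne hx0),
      hu.eventually (A.continuous.continuousAt.eventually_ne hA)] with n h0 h1 h2 h3
    have hrec' : ∀ k, (W (k + 2)).eval (u n) =
        A.eval (u n) * (W (k + 1)).eval (u n) + B.eval (u n) * (W k).eval (u n) := by
      intro k; rw [hrec k]; simp
    have hb := binet (w := fun k => (W k).eval (u n)) hrec' (hadd _) (hmul _ h3) n
    simp only [h0, mul_zero] at hb
    -- Binet's formula at a zero of `W n`; the factor `(y/x)^n` decays geometrically near `z`.
    have he : (W 1).eval (u n) - y (u n) * (W 0).eval (u n) =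
        (y (u n) / x (u n)) ^ n * ((W 1).eval (u n) - x (u n) * (W 0).eval (u n)) := by
      rw [div_pow]
      field_simp
      linear_combination -hb
    rw [he, norm_mul, norm_pow]
    gcongr
  have hfin := tendsto_nhds_unique hP hP0
  have h1 := hadd z
  have h2 := hmul z hA
  simp only [eval_sub, eval_pow, eval_mul]
  rw [← h1]
  linear_combination ((W 1).eval z - x z * (W 0).eval z) * hfin - (W 0).eval z ^ 2 * h2

/-! ### Zeros near equimodular points -/

open Metric in
/-- Small perturbations of a nonconstant holomorphic function keep a nearby zero. -/
lemma exists_pos_forall_exists_eq {φ γ : ℂ → ℂ} {z₀ : ℂ}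
    (hφ : ∀ᶠ z in 𝓝 z₀, DifferentiableAt ℂ φ z) (hγ : ∀ᶠ z in 𝓝 z₀, DifferentiableAt ℂ γ z)
    (h0 : φ z₀ = 0) (hne : ∀ᶠ z in 𝓝[≠] z₀, φ z ≠ 0) {r : ℝ} (hr : 0 < r) :
    ∃ δ > 0, ∀ η κ : ℂ, ‖η‖ < δ → ‖κ‖ < δ → ∃ z ∈ ball z₀ r, φ z = η * γ z + κ := by
  rw [eventually_nhdsWithin_iff] at hne
  obtain ⟨R', hR', hball⟩ := Metric.eventually_nhds_iff_ball.1 (hφ.and (hγ.and hne))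
  obtain ⟨R, hR0, hR⟩ := exists_between (lt_min hr hR')
  rw [lt_min_iff] at hR
  have hsub : closedBall z₀ R ⊆ ball z₀ R' := closedBall_subset_ball hR.2
  have hφc : ContinuousOn φ (closedBall z₀ R) := fun z hz =>
    (hball z (hsub hz)).1.continuousAt.continuousWithinAt
  have hγc : ContinuousOn γ (closedBall z₀ R) := fun z hz =>
    (hball z (hsub hz)).2.1.continuousAt.continuousWithinAt
  obtain ⟨M, hM⟩ := (isCompact_closedBall z₀ R).exists_bound_of_continuousOn hγc
  have hM0 : 0 ≤ M := (norm_nonneg _).trans (hM z₀ (mem_closedBall_self hR0.le))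
  obtain ⟨p, hp, hpmin⟩ := (isCompact_sphere z₀ R).exists_isMinOn
    (NormedSpace.sphere_nonempty.2 hR0.le) (hφc.mono sphere_subset_closedBall).norm
  set ε := ‖φ p‖ with hε
  have hpne : p ≠ z₀ := ne_of_mem_sphere hp hR0.ne'
  have hε0 : 0 < ε := norm_pos_iff.2 ((hball p (hsub (sphere_subset_closedBall hp))).2.2 hpne)
  have hδ : 0 < ε / (8 * (M + 1)) := by positivity
  -- With this bound `η γ` moves `φ` by at most `ε/8`, so `f - f z₀` stays at least `ε/2` on the
  -- sphere. The `+ 1` pays for `κ`, which lands within `ε/4` of `f z₀`, the radius the quantitative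
  -- open mapping theorem covers.
  refine ⟨ε / (8 * (M + 1)), hδ, fun η κ hη hκ => ?_⟩
  have hδM : ε / (8 * (M + 1)) * (M + 1) = ε / 8 := by field_simp
  have hηγ : ∀ z ∈ closedBall z₀ R, ‖η * γ z‖ ≤ ε / (8 * (M + 1)) * M := by
    intro z hz
    rw [norm_mul]
    exact mul_le_mul hη.le (hM z hz) (norm_nonneg _) hδ.le
  set f : ℂ → ℂ := fun z => φ z - η * γ z with hf
  have hfd : DifferentiableOn ℂ f (ball z₀ R') := fun z hz =>
    ((hball z hz).1.sub ((hball z hz).2.1.const_mul η)).differentiableWithinAt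
  have hfz : f z₀ = -(η * γ z₀) := by simp [hf, h0]
  have hz₀ := hηγ z₀ (mem_closedBall_self hR0.le)
  have hge : ∀ z ∈ sphere z₀ R, ε / 2 ≤ ‖f z - f z₀‖ := by
    intro z hz
    have h1 : ε ≤ ‖φ z‖ := hpmin hz
    have h2 := hηγ z (sphere_subset_closedBall hz)
    have h3 : f z - f z₀ = φ z - (η * γ z - η * γ z₀) := by rw [hfz]; simp only [hf]; ring
    have h4 := norm_sub_norm_le (φ z) (η * γ z - η * γ z₀)
    have h5 := norm_sub_le (η * γ z) (η * γ z₀)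
    rw [h3]
    linarith
  have himg := DiffContOnCl.ball_subset_image_closedBall
    (f := f) (z₀ := z₀) (r := R) (ε := ε / 2) ((hfd.mono hsub).diffContOnCl_ball subset_rfl)
    hR0 hge (by
      intro hcon
      have hev : f =ᶠ[𝓝 z₀] fun _ => f z₀ := by
        filter_upwards [hcon] with z hz using not_not.1 hz
      have heq := (hfd.analyticOnNhd isOpen_ball).eqOn_of_preconnected_of_eventuallyEq
        analyticOnNhd_const (convex_ball z₀ R').isPreconnected (mem_ball_self hR') hev
      have h1 := hge p hp
      rw [heq (hsub (sphere_subset_closedBall hp))] at h1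
      simp at h1
      linarith)
  have hmem : κ ∈ ball (f z₀) (ε / 2 / 2) := by
    rw [mem_ball_iff_norm, hfz, sub_neg_eq_add]
    have := norm_add_le κ (η * γ z₀)
    linarith
  obtain ⟨z, hz, hzκ⟩ := himg hmem
  refine ⟨z, closedBall_subset_ball hR.1 hz, ?_⟩
  simp only [hf] at hzκ
  linear_combination hzκ

open Metric in
/-- If `x / y` has modulus one at `z₀` and is not locally constant, then `x ^ n P = y ^ n Q` has
solutions near `z₀` for all large `n`. -/
lemma eventually_exists_pow_mul_eq {x y P Q : ℂ → ℂ} {z₀ : ℂ}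
    (hxd : ∀ᶠ z in 𝓝 z₀, DifferentiableAt ℂ x z) (hyd : ∀ᶠ z in 𝓝 z₀, DifferentiableAt ℂ y z)
    (hPd : ∀ᶠ z in 𝓝 z₀, DifferentiableAt ℂ P z) (hQd : ∀ᶠ z in 𝓝 z₀, DifferentiableAt ℂ Q z)
    (hx0 : x z₀ ≠ 0) (hy0 : y z₀ ≠ 0) (hP0 : P z₀ ≠ 0) (hQ0 : Q z₀ ≠ 0)
    (hnorm : ‖x z₀‖ = ‖y z₀‖) (hne : ∀ᶠ z in 𝓝[≠] z₀, x z / y z ≠ x z₀ / y z₀)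
    {r : ℝ} (hr : 0 < r) :
    ∀ᶠ n : ℕ in atTop, ∃ z ∈ ball z₀ r, x z ^ n * P z = y z ^ n * Q z := by
  set h₀ := x z₀ / y z₀ with hh₀
  set g₀ := Q z₀ / P z₀ with hg₀
  have hh₀0 : h₀ ≠ 0 := div_ne_zero hx0 hy0
  have hg₀0 : g₀ ≠ 0 := div_ne_zero hQ0 hP0
  have hcx := hxd.self_of_nhds.continuousAt
  have hcy := hyd.self_of_nhds.continuousAt
  have hcP := hPd.self_of_nhds.continuousAt
  have hcQ := hQd.self_of_nhds.continuousAt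
  have hnz : ∀ᶠ z in 𝓝 z₀, (x z ≠ 0 ∧ y z ≠ 0) ∧ P z ≠ 0 ∧ Q z ≠ 0 :=
    ((hcx.eventually_ne hx0).and (hcy.eventually_ne hy0)).and
      ((hcP.eventually_ne hP0).and (hcQ.eventually_ne hQ0))
  have hslit_h : ∀ᶠ z in 𝓝 z₀, x z / y z / h₀ ∈ Complex.slitPlane := by
    have hc : ContinuousAt (fun z => x z / y z / h₀) z₀ := (hcx.div hcy hy0).div_const h₀
    apply hc.eventually_mem
    apply Complex.isOpen_slitPlane.mem_nhds
    simp [← hh₀, div_self hh₀0]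
  have hslit_g : ∀ᶠ z in 𝓝 z₀, Q z / P z / g₀ ∈ Complex.slitPlane := by
    have hc : ContinuousAt (fun z => Q z / P z / g₀) z₀ := (hcQ.div hcP hP0).div_const g₀
    apply hc.eventually_mem
    apply Complex.isOpen_slitPlane.mem_nhds
    simp [← hg₀, div_self hg₀0]
  obtain ⟨R', hR', hball⟩ := Metric.eventually_nhds_iff_ball.1 hnz
  -- Logarithms turn `h^n = g`, with `h = x/y` and `g = Q/P`, into `log (h/h₀) = (1/n) log (g/g₀) +
  -- c/n`. Normalising by the values at `z₀` keeps both arguments near 1.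
  obtain ⟨δ, hδ, hsol⟩ := exists_pos_forall_exists_eq
    (φ := fun z => Complex.log (x z / y z / h₀)) (γ := fun z => Complex.log (Q z / P z / g₀))
    (z₀ := z₀)
    (by
      filter_upwards [hxd, hyd, hnz, hslit_h] with z h1 h2 h3 h4
      exact ((h1.div h2 h3.1.2).div_const h₀).clog h4)
    (by
      filter_upwards [hPd, hQd, hnz, hslit_g] with z h1 h2 h3 h4
      exact ((h2.div h1 h3.2.1).div_const g₀).clog h4)
    (by simp [← hh₀, div_self hh₀0])
    (by
      filter_upwards [hne, hnz.filter_mono nhdsWithin_le_nhds] with z h1 h2 h3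
      have h4 : x z / y z / h₀ ≠ 0 := div_ne_zero (div_ne_zero h2.1.1 h2.1.2) hh₀0
      have h5 := Complex.exp_log h4
      rw [h3, Complex.exp_zero] at h5
      exact h1 ((div_eq_one_iff_eq hh₀0).1 h5.symm))
    (lt_min hr hR')
  -- Bounds `c = log (g₀ / h₀^n)` uniformly in `n`: its real part is `log ‖g₀‖` because `‖h₀‖ = 1`,
  -- and its imaginary part is an argument.
  set K := |Real.log ‖g₀‖| + Real.pi with hK
  have hnh₀ : ‖h₀‖ = 1 := by
    rw [hh₀, norm_div, hnorm, div_self (norm_ne_zero_iff.2 hy0)]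
  have hlarge : ∀ᶠ n : ℕ in atTop, (1 + K) / δ < n :=
    tendsto_natCast_atTop_atTop.eventually_gt_atTop _
  filter_upwards [hlarge, eventually_gt_atTop 0] with n hn hn0
  have hnpos : (0 : ℝ) < n := by exact_mod_cast hn0
  have hK0 : 0 ≤ K := by positivity
  set c := Complex.log (g₀ / h₀ ^ n) with hc
  have hcK : ‖c‖ ≤ K := by
    refine (Complex.norm_le_abs_re_add_abs_im c).trans ?_
    rw [hc, Complex.log_re, norm_div, norm_pow, hnh₀, one_pow, div_one, Complex.log_im]
    exact add_le_add le_rfl (Complex.abs_arg_le_pi _)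
  rw [div_lt_iff₀ hδ] at hn
  obtain ⟨z, hz, heq⟩ := hsol (1 / n) (c / n)
    (by
      rw [norm_div, norm_one, Complex.norm_natCast, div_lt_iff₀ hnpos]
      linarith)
    (by
      rw [norm_div, Complex.norm_natCast, div_lt_iff₀ hnpos]
      linarith)
  obtain ⟨⟨hxz, hyz⟩, hPz, hQz⟩ := hball z (ball_subset_ball (min_le_right _ _) hz)
  refine ⟨z, ball_subset_ball (min_le_left _ _) hz, ?_⟩
  have hnC : (n : ℂ) ≠ 0 := by exact_mod_cast hn0.ne'
  have h1 : (n : ℂ) * Complex.log (x z / y z / h₀) = Complex.log (Q z / P z / g₀) + c := by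
    rw [heq]; field_simp
  have h2 := congrArg Complex.exp h1
  rw [Complex.exp_nat_mul, Complex.exp_add,
    Complex.exp_log (div_ne_zero (div_ne_zero hxz hyz) hh₀0),
    Complex.exp_log (div_ne_zero (div_ne_zero hQz hPz) hg₀0), hc,
    Complex.exp_log (div_ne_zero hg₀0 (pow_ne_zero _ hh₀0)), div_pow, div_pow] at h2
  have h3 : h₀ ^ n ≠ 0 := pow_ne_zero _ hh₀0
  have h4 : y z ^ n ≠ 0 := pow_ne_zero _ hyz
  field_simp at h2
  linear_combination h2

/-- On the equimodular curve, away from zeros of the characteristic polynomial, every point is a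
limit of zeros. -/
lemma mem_limitsOfZeros_of_equimodular {A B : ℂ[X]} {W : ℕ → ℂ[X]} (hrec : SatisfiesRec A B W)
    {z₀ : ℂ} {s : ℝ} (hs : s ∈ Set.Ioo 0 4) (hz₀ : A.eval z₀ ^ 2 + s * B.eval z₀ = 0)
    (hB : B.eval z₀ ≠ 0)
    (hne : ∀ᶠ z in 𝓝[≠] z₀, A.eval z ^ 2 * B.eval z₀ ≠ A.eval z₀ ^ 2 * B.eval z)
    (hchar : (W 1 ^ 2 - A * W 0 * W 1 - B * W 0 ^ 2).eval z₀ ≠ 0) :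
    z₀ ∈ limitsOfZeros W := by
  have hsC : (s : ℂ) ≠ 0 := by exact_mod_cast hs.1.ne'
  have hA : A.eval z₀ ≠ 0 := by
    intro h
    rw [h] at hz₀
    simp [hsC, hB] at hz₀
  -- The minus sign makes `τ z₀ = 4/s - 1` positive, away from the cut of the square root. At `z₀`
  -- the factors `1 ± i√τ` are then conjugate, whence equal moduli.
  set τ : ℂ → ℂ := fun w => -(A.eval w ^ 2 + 4 * B.eval w) / A.eval w ^ 2 with hτ
  have hτz : τ z₀ = ((4 / s - 1 : ℝ) : ℂ) := by
    simp only [hτ]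
    push_cast
    field_simp
    linear_combination -4 * hz₀
  have ht0 : 0 < 4 / s - 1 := by
    rw [sub_pos, lt_div_iff₀ hs.1]; linarith [hs.2]
  have hAn : ∀ᶠ z in 𝓝 z₀, A.eval z ≠ 0 := A.continuous.continuousAt.eventually_ne hA
  have hτd (z) (hz : A.eval z ≠ 0) : DifferentiableAt ℂ τ z :=
    (((A.differentiableAt.pow 2).add (B.differentiableAt.const_mul 4)).neg).div
      (A.differentiableAt.pow 2) (pow_ne_zero 2 hz)
  have hslit : ∀ᶠ z in 𝓝 z₀, τ z ∈ Complex.slitPlane := by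
    apply (hτd z₀ hA).continuousAt.eventually_mem
    apply Complex.isOpen_slitPlane.mem_nhds
    rw [hτz, Complex.ofReal_mem_slitPlane]
    exact ht0
  set σ : ℂ → ℂ := fun w => Complex.sqrt (τ w) with hσ
  have hσd : ∀ᶠ z in 𝓝 z₀, DifferentiableAt ℂ σ z := by
    filter_upwards [hAn, hslit] with z h1 h2
    exact (Complex.differentiableAt_sqrt h2).comp z (hτd z h1)
  have hσz : σ z₀ = (Real.sqrt (4 / s - 1) : ℂ) := by
    simp only [hσ]
    rw [hτz, Complex.sqrt_of_nonneg (by exact_mod_cast ht0.le), Complex.ofReal_re]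
  have hρ0 : 0 < Real.sqrt (4 / s - 1) := Real.sqrt_pos.2 ht0
  set ρ := Real.sqrt (4 / s - 1)
  set x : ℂ → ℂ := fun w => A.eval w * (1 + Complex.I * σ w) / 2 with hx
  set y : ℂ → ℂ := fun w => A.eval w * (1 - Complex.I * σ w) / 2 with hy
  have hxd : ∀ᶠ z in 𝓝 z₀, DifferentiableAt ℂ x z := by
    filter_upwards [hσd] with z h
    exact (A.differentiableAt.mul ((h.const_mul _).const_add 1)).div_const 2
  have hyd : ∀ᶠ z in 𝓝 z₀, DifferentiableAt ℂ y z := by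
    filter_upwards [hσd] with z h
    exact (A.differentiableAt.mul ((h.const_mul _).const_sub 1)).div_const 2
  have hadd (w) : x w + y w = A.eval w := by simp only [hx, hy]; ring
  have hmul (w) (hw : A.eval w ≠ 0) : x w * y w = -B.eval w := by
    have h1 : x w * y w = A.eval w ^ 2 * (1 - Complex.I ^ 2 * σ w ^ 2) / 4 := by
      simp only [hx, hy]; ring
    rw [h1, sqrt_sq, Complex.I_sq]
    simp only [hτ]
    field_simp
    ring
  have hxy0 : x z₀ * y z₀ ≠ 0 := by rw [hmul z₀ hA]; exact neg_ne_zero.2 hB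
  have hx0 := left_ne_zero_of_mul hxy0
  have hy0 := right_ne_zero_of_mul hxy0
  have hnorm : ‖x z₀‖ = ‖y z₀‖ := by
    simp only [hx, hy, norm_div, norm_mul, hσz]
    congr 2
    rw [← Complex.norm_conj]
    simp [sub_eq_add_neg]
  have hsub : x z₀ - y z₀ ≠ 0 := by
    have : x z₀ - y z₀ = A.eval z₀ * (Complex.I * ρ) := by simp only [hx, hy, hσz]; ring
    rw [this]
    have : (ρ : ℂ) ≠ 0 := by exact_mod_cast hρ0.ne'
    exact mul_ne_zero hA (mul_ne_zero Complex.I_ne_zero this)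
  have hPQ : ((W 1).eval z₀ - y z₀ * (W 0).eval z₀) * ((W 1).eval z₀ - x z₀ * (W 0).eval z₀)
      ≠ 0 := by
    convert hchar using 1
    simp only [eval_sub, eval_pow, eval_mul]
    rw [← hadd z₀]
    linear_combination (W 0).eval z₀ ^ 2 * hmul z₀ hA
  have hxyd := hxd.self_of_nhds.continuousAt.sub hyd.self_of_nhds.continuousAt
  -- Inside this ball `x ≠ y`, so the factor `x - y` in Binet's formula can be cancelled.
  obtain ⟨R, hR, hball⟩ := Metric.eventually_nhds_iff_ball.1 (hAn.and (hxyd.eventually_ne hsub))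
  rw [mem_limitsOfZeros_iff]
  intro ε hε
  have := eventually_exists_pow_mul_eq (x := x) (y := y)
    (P := fun z => (W 1).eval z - y z * (W 0).eval z)
    (Q := fun z => (W 1).eval z - x z * (W 0).eval z) hxd hyd
    (by
      filter_upwards [hyd] with z h
      exact (W 1).differentiableAt.sub (h.mul (W 0).differentiableAt))
    (by
      filter_upwards [hxd] with z h
      exact (W 1).differentiableAt.sub (h.mul (W 0).differentiableAt))
    hx0 hy0 (left_ne_zero_of_mul hPQ) (right_ne_zero_of_mul hPQ) hnorm
    (by
      -- The ratio `x/y` determines `A^2/B`, so equality of the ratios at `z` and `z₀` contradicts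
      -- `hne`.
      have hyn : ∀ᶠ z in 𝓝 z₀, y z ≠ 0 := hyd.self_of_nhds.continuousAt.eventually_ne hy0
      filter_upwards [hne, hAn.filter_mono nhdsWithin_le_nhds,
        hyn.filter_mono nhdsWithin_le_nhds] with z h1 h2 h3 h4
      apply h1
      have hB1 : B.eval z = -(x z * y z) := by rw [hmul z h2]; ring
      have hB2 : B.eval z₀ = -(x z₀ * y z₀) := by rw [hmul z₀ hA]; ring
      rw [hB1, hB2, ← hadd z, ← hadd z₀]
      have h5 : x z = x z₀ / y z₀ * y z := by rw [← h4]; field_simp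
      rw [h5]
      field_simp)
    (lt_min hε hR)
  filter_upwards [this] with n hn
  obtain ⟨z, hz, heq⟩ := hn
  refine ⟨z, Metric.ball_subset_ball (min_le_left _ _) hz, ?_⟩
  obtain ⟨h1, h2⟩ := hball z (Metric.ball_subset_ball (min_le_right _ _) hz)
  have hrec' : ∀ k, (W (k + 2)).eval z =
      A.eval z * (W (k + 1)).eval z + B.eval z * (W k).eval z := by
    intro k; rw [hrec k]; simp
  have hb := binet (w := fun k => (W k).eval z) hrec' (hadd _) (hmul _ h1) n
  rw [heq, sub_self] at hb
  exact (mul_eq_zero.1 hb).resolve_left h2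

/-! ### Non-isolated limits are the equimodular points -/

/-- The set where the two characteristic roots of `t ^ 2 = A t + B` have equal moduli. -/
def equimodularSet (A B : ℂ[X]) : Set ℂ :=
  {z | ∃ s ∈ Set.Icc (0 : ℝ) 4, A.eval z ^ 2 + s * B.eval z = 0}

/-- The parameter `s` ranges over a compact interval, and projection along a compact factor is
closed. -/
lemma isClosed_equimodularSet (A B : ℂ[X]) : IsClosed (equimodularSet A B) := by
  have h : IsClosed {p : Set.Icc (0 : ℝ) 4 × ℂ |
      A.eval p.2 ^ 2 + ((p.1 : ℝ) : ℂ) * B.eval p.2 = 0} := by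
    refine isClosed_eq ?_ continuous_const
    have hA := A.continuous.comp (continuous_snd (X := Set.Icc (0 : ℝ) 4))
    have hB := B.continuous.comp (continuous_snd (X := Set.Icc (0 : ℝ) 4))
    exact (hA.pow 2).add ((Complex.continuous_ofReal.comp
      (continuous_subtype_val.comp continuous_fst)).mul hB)
  convert isClosedMap_snd_of_compactSpace _ h using 1
  ext z
  simp [equimodularSet]

lemma eval_char_eq_zero_of_notMem {A B : ℂ[X]} {W : ℕ → ℂ[X]} (hrec : SatisfiesRec A B W)
    {z : ℂ} (hz : z ∉ equimodularSet A B) (hlim : z ∈ limitsOfZeros W) :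
    (W 1 ^ 2 - A * W 0 * W 1 - B * W 0 ^ 2).eval z = 0 := by
  have hA : A.eval z ≠ 0 := fun h => hz ⟨0, by simp, by simp [h]⟩
  refine eval_char_eq_zero_of_slitPlane hrec hA ?_ hlim
  by_contra hns
  obtain ⟨hre, him⟩ : ((A.eval z ^ 2 + 4 * B.eval z) / A.eval z ^ 2).re ≤ 0 ∧
      ((A.eval z ^ 2 + 4 * B.eval z) / A.eval z ^ 2).im = 0 := by
    simpa [Complex.mem_slitPlane_iff] using hns
  set τ := (A.eval z ^ 2 + 4 * B.eval z) / A.eval z ^ 2 with hτ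
  have hreal : ((τ.re : ℝ) : ℂ) = τ := Complex.ext rfl (by simp [him])
  have hpos : 0 < 1 - τ.re := by linarith
  have hC : (1 : ℂ) - τ ≠ 0 := by
    rw [← hreal]
    exact_mod_cast hpos.ne'
  -- Since `1 - τ = -4B/A^2`, this is `s = -A^2/B`; it is at most 4 because `τ ≤ 0`.
  refine hz ⟨4 / (1 - τ.re), ⟨by positivity, ?_⟩, ?_⟩
  · rw [div_le_iff₀ hpos]; linarith
  · push_cast
    rw [hreal]
    have h1 : τ * A.eval z ^ 2 = A.eval z ^ 2 + 4 * B.eval z := by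
      rw [hτ]; field_simp
    field_simp
    linear_combination -h1

lemma eventually_ne_of_ne_zero {p : ℂ[X]} (hp : p ≠ 0) (z : ℂ) :
    ∀ᶠ w in 𝓝[≠] z, p.eval w ≠ 0 := by
  have hfin : {w | p.eval w = 0}.Finite := by
    refine (p.rootSet_finite ℂ).subset fun w hw => ?_
    simpa [mem_rootSet, hp] using hw
  filter_upwards [(hfin.subset (Set.sdiff_subset (t := {z}))).isClosed.isOpen_compl.mem_nhds
    (x := z) (by simp) |> mem_nhdsWithin_of_mem_nhds, self_mem_nhdsWithin] with w h1 h2 h3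
  exact h1 ⟨h3, h2⟩

lemma eval_ne_zero_of_mem_equimodularSet {A B : ℂ[X]}
    (hAB : ¬ ∃ z : ℂ, A.eval z = 0 ∧ B.eval z = 0) {z : ℂ} (hz : z ∈ equimodularSet A B) :
    B.eval z ≠ 0 := by
  intro h
  obtain ⟨s, -, hs⟩ := hz
  rw [h] at hs
  exact hAB ⟨z, by simpa using hs, h⟩

/-- The function `A^2/B` is not constant: it vanishes at a zero of `A`, where `B` does not, yet `A`
is not identically zero. Hence no value is repeated close to `z₀`. -/
lemma eventually_sq_mul_ne {A B : ℂ[X]} (hAB : ¬ ∃ z : ℂ, A.eval z = 0 ∧ B.eval z = 0)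
    (hA : A ≠ 0) (hroot : ∃ z, A.eval z = 0) {z₀ : ℂ} (hB : B.eval z₀ ≠ 0) :
    ∀ᶠ z in 𝓝[≠] z₀, A.eval z ^ 2 * B.eval z₀ ≠ A.eval z₀ ^ 2 * B.eval z := by
  have hp : A ^ 2 * C (B.eval z₀) - C (A.eval z₀ ^ 2) * B ≠ 0 := by
    intro h
    obtain ⟨r, hr⟩ := hroot
    have hBr : B.eval r ≠ 0 := fun h => hAB ⟨r, hr, h⟩
    have h1 := congrArg (eval r) h
    have h2 : A.eval z₀ = 0 := by simpa [hr, hBr] using h1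
    rw [h2] at h
    simp [hA, hB] at h
  filter_upwards [eventually_ne_of_ne_zero hp z₀] with z hz h
  apply hz
  simp [h]

/-- The non-isolated limits of zeros are exactly the points of the equimodular set. -/
theorem nonIsolatedLimits_eq_equimodularSet {A B : ℂ[X]} {W : ℕ → ℂ[X]}
    (hrec : SatisfiesRec A B W) (hgen : IsGeneral A B W) (hA : A ≠ 0)
    (hroot : ∃ z, A.eval z = 0) : nonIsolatedLimits W = equimodularSet A B := by
  have hAB := hgen.no_common_zero_coeff
  set D := W 1 ^ 2 - A * W 0 * W 1 - B * W 0 ^ 2 with hD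
  ext z₀
  constructor
  · rintro ⟨hz, hacc⟩
    by_contra hnot
    rw [accPt_iff_nhds] at hacc
    have hU : (equimodularSet A B)ᶜ ∈ 𝓝 z₀ :=
      (isClosed_equimodularSet A B).isOpen_compl.mem_nhds hnot
    have hV := eventually_nhdsWithin_iff.1 (eventually_ne_of_ne_zero hgen.char_ne_zero z₀)
    obtain ⟨y, ⟨⟨hy1, hy2⟩, hyL⟩, hy⟩ := hacc _ (inter_mem hU hV)
    exact hy2 hy (eval_char_eq_zero_of_notMem hrec hy1 hyL)
  · intro hz
    have hB := eval_ne_zero_of_mem_equimodularSet hAB hz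
    have hne := eventually_sq_mul_ne hAB hA hroot hB
    obtain ⟨s₀, ⟨hs0, hs4⟩, hs⟩ := hz
    set f : ℂ → ℂ := fun z => -(A.eval z ^ 2) / B.eval z with hf
    have hBn : ∀ᶠ z in 𝓝 z₀, B.eval z ≠ 0 := B.continuous.continuousAt.eventually_ne hB
    have hfa : AnalyticAt ℂ f z₀ := by
      rw [Complex.analyticAt_iff_eventually_differentiableAt]
      filter_upwards [hBn] with z hz
      exact ((A.differentiableAt.pow 2).neg).div B.differentiableAt hz
    have hfz : f z₀ = s₀ := by
      simp only [hf]
      field_simp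
      linear_combination -hs
    -- The open mapping theorem lets `s` vary freely near `s₀`. This produces equimodular points
    -- near `z₀` with `s` in the open interval, avoiding the ends 0 and 4 and the zeros of `D`;
    -- closedness of the limit set then captures `z₀` itself.
    have hopen : 𝓝 (f z₀) ≤ map f (𝓝 z₀) := by
      refine hfa.eventually_constant_or_nhds_le_map_nhds.resolve_left fun hcon => ?_
      obtain ⟨z, h1, h2, h3⟩ := (hne.and ((hBn.filter_mono nhdsWithin_le_nhds).and
        (hcon.filter_mono nhdsWithin_le_nhds))).exists
      apply h1
      simp only [hf] at h3
      field_simp at h3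
      linear_combination -h3
    have hacc : AccPt z₀ (𝓟 (limitsOfZeros W)) := by
      rw [accPt_iff_nhds]
      intro U hU
      have hV := eventually_nhdsWithin_iff.1 (eventually_ne_of_ne_zero hgen.char_ne_zero z₀)
      have hG : f '' (U ∩ ({z | B.eval z ≠ 0} ∩ {z | z ∈ ({z₀} : Set ℂ)ᶜ → D.eval z ≠ 0})) ∈
          𝓝 ((s₀ : ℝ) : ℂ) := by
        rw [← hfz]
        exact hopen (image_mem_map (inter_mem hU (inter_mem hBn hV)))
      obtain ⟨ε, hε, hball⟩ := Metric.mem_nhds_iff.1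
        (Complex.continuous_ofReal.continuousAt.preimage_mem_nhds hG)
      obtain ⟨s, hs', hss₀, hsd⟩ : ∃ s ∈ Set.Ioo (0 : ℝ) 4, s ≠ s₀ ∧ s ∈ Metric.ball s₀ ε := by
        have hm : 0 < min (ε / 2) 1 := lt_min (half_pos hε) one_pos
        have hm1 : min (ε / 2) 1 ≤ ε / 2 := min_le_left _ _
        have hm2 : min (ε / 2) 1 ≤ 1 := min_le_right _ _
        rcases le_total s₀ 2 with h | h
        · refine ⟨s₀ + min (ε / 2) 1, ⟨by linarith, by linarith⟩, by linarith, ?_⟩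
          rw [Metric.mem_ball, Real.dist_eq, add_sub_cancel_left, abs_of_pos hm]
          linarith
        · refine ⟨s₀ - min (ε / 2) 1, ⟨by linarith, by linarith⟩, by linarith, ?_⟩
          rw [Metric.mem_ball, Real.dist_eq, sub_sub_cancel_left, abs_neg, abs_of_pos hm]
          linarith
      obtain ⟨y, ⟨hyU, hyB, hyD⟩, hys⟩ := hball hsd
      have hyne : y ≠ z₀ := by
        rintro rfl
        rw [hfz] at hys
        exact hss₀ (by exact_mod_cast hys.symm)
      refine ⟨y, ⟨hyU, ?_⟩, hyne⟩
      refine mem_limitsOfZeros_of_equimodular hrec hs' ?_ hyB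
        (eventually_sq_mul_ne hAB hA hroot hyB) (hyD hyne)
      rw [← hys]
      simp only [hf]
      have : B.eval y ≠ 0 := hyB
      field_simp
      ring
    exact ⟨(isClosed_limitsOfZeros W).closure_subset hacc.clusterPt.mem_closure, hacc⟩

/-! ### Real solution sets of quadratic inequalities -/

lemma image_ofReal_eq (T : Set ℝ) : Complex.ofReal '' T = {z : ℂ | z.im = 0 ∧ z.re ∈ T} := by
  ext z
  constructor
  · rintro ⟨t, ht, rfl⟩
    exact ⟨Complex.ofReal_im t, ht⟩
  · rintro ⟨h1, h2⟩
    exact ⟨z.re, h2, Complex.ext rfl (by simp [h1])⟩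

lemma mul_nonneg_iff_of_neg_left {a b : ℝ} (ha : a < 0) : 0 ≤ a * b ↔ b ≤ 0 := by
  constructor <;> intro h <;> nlinarith

lemma mul_nonpos_iff_of_neg_left {a b : ℝ} (ha : a < 0) : a * b ≤ 0 ↔ 0 ≤ b := by
  constructor <;> intro h <;> nlinarith

lemma mul_nonpos_iff_of_pos_left {a b : ℝ} (ha : 0 < a) : a * b ≤ 0 ↔ b ≤ 0 := by
  constructor <;> intro h <;> nlinarith

lemma setOf_mul_nonpos {l u : ℝ} (h : l < u) : {v : ℝ | (v - l) * (v - u) ≤ 0} = Set.Icc l u := by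
  ext v
  simp only [Set.mem_ofPred_eq, Set.mem_Icc, mul_nonpos_iff]
  constructor
  · rintro (⟨h1, h2⟩ | ⟨h1, h2⟩)
    · constructor <;> linarith
    · linarith
  · rintro ⟨h1, h2⟩
    left
    constructor <;> linarith

lemma setOf_mul_nonneg {l u : ℝ} (h : l < u) :
    {v : ℝ | 0 ≤ (v - l) * (v - u)} = Set.Iic l ∪ Set.Ici u := by
  ext v
  simp only [Set.mem_ofPred_eq, Set.mem_union, Set.mem_Iic, Set.mem_Ici, mul_nonneg_iff]
  constructor
  · rintro (⟨h1, h2⟩ | ⟨h1, h2⟩)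
    · right; linarith
    · left; linarith
  · rintro (h1 | h1)
    · right; constructor <;> linarith
    · left; constructor <;> linarith

lemma isRealShape_mul_nonpos {l u : ℝ} (h : l ≠ u) :
    IsRealShape (Complex.ofReal '' {v : ℝ | (v - l) * (v - u) ≤ 0}) := by
  wlog hlt : l < u generalizing l u
  · simpa only [mul_comm] using this h.symm (lt_of_le_of_ne (not_lt.1 hlt) h.symm)
  rw [setOf_mul_nonpos hlt]
  exact Or.inr (Or.inl ⟨l, u, hlt, rfl⟩)

lemma isRealShape_mul_nonneg {l u : ℝ} (h : l ≠ u) :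
    IsRealShape (Complex.ofReal '' {v : ℝ | 0 ≤ (v - l) * (v - u)}) := by
  wlog hlt : l < u generalizing l u
  · simpa only [mul_comm] using this h.symm (lt_of_le_of_ne (not_lt.1 hlt) h.symm)
  rw [setOf_mul_nonneg hlt, Set.image_union]
  refine Or.inr (Or.inr (Or.inr ⟨_, _, ⟨l, Or.inr rfl⟩, ⟨u, Or.inl rfl⟩, ?_, rfl⟩))
  rw [Set.disjoint_image_iff Complex.ofReal_injective]
  exact Set.disjoint_left.2 fun v h1 h2 => by
    simp only [Set.mem_Iic, Set.mem_Ici] at h1 h2; linarith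

lemma isRealRay_setOf_nonneg (x₀ : ℝ) {μ : ℝ} (h : μ ≠ 0) :
    IsRealRay (Complex.ofReal '' {v : ℝ | 0 ≤ 1 - μ * (v - x₀)}) := by
  refine ⟨x₀ + μ⁻¹, ?_⟩
  have key (v : ℝ) : 1 - μ * (v - x₀) = μ * (x₀ + μ⁻¹ - v) := by field_simp; ring
  rcases h.lt_or_gt with h | h
  · left
    congr 1
    ext v
    simp only [Set.mem_ofPred_eq, Set.mem_Ici, key]
    rw [mul_nonneg_iff_of_neg_left h, sub_nonpos]
  · right
    congr 1
    ext v
    simp only [Set.mem_ofPred_eq, Set.mem_Iic, key]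
    rw [mul_nonneg_iff_of_pos_left h, sub_nonneg]

lemma isRealRay_setOf_nonpos (x₀ : ℝ) {μ : ℝ} (h : μ ≠ 0) :
    IsRealRay (Complex.ofReal '' {v : ℝ | 1 - μ * (v - x₀) ≤ 0}) := by
  refine ⟨x₀ + μ⁻¹, ?_⟩
  have key (v : ℝ) : 1 - μ * (v - x₀) = μ * (x₀ + μ⁻¹ - v) := by field_simp; ring
  rcases h.lt_or_gt with h | h
  · right
    congr 1
    ext v
    simp only [Set.mem_ofPred_eq, Set.mem_Iic, key]
    rw [mul_nonpos_iff_of_neg_left h, sub_nonneg]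
  · left
    congr 1
    ext v
    simp only [Set.mem_ofPred_eq, Set.mem_Ici, key]
    rw [mul_nonpos_iff_of_pos_left h, sub_nonpos]

lemma one_sub_mul_one_sub (x₀ v : ℝ) {lo hi : ℝ} (h1 : lo ≠ 0) (h2 : hi ≠ 0) :
    (1 - lo * (v - x₀)) * (1 - hi * (v - x₀)) =
      lo * hi * ((v - (x₀ + lo⁻¹)) * (v - (x₀ + hi⁻¹))) := by
  field_simp
  ring

/-- The end points are `x₀ + 1/lo` and `x₀ + 1/hi`. If one slope vanishes, its end point goes to
infinity and a ray remains; otherwise the sign of `lo * hi` decides between an interval and two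
rays. -/
lemma isRealShape_quadratic_nonpos (x₀ : ℝ) {lo hi : ℝ} (h : lo ≠ hi) :
    IsRealShape (Complex.ofReal '' {v : ℝ | (1 - lo * (v - x₀)) * (1 - hi * (v - x₀)) ≤ 0}) := by
  rcases eq_or_ne lo 0 with rfl | h1
  · have := isRealRay_setOf_nonpos x₀ h.symm
    exact Or.inr (Or.inr (Or.inl (by simpa using this)))
  rcases eq_or_ne hi 0 with rfl | h2
  · have := isRealRay_setOf_nonpos x₀ h
    exact Or.inr (Or.inr (Or.inl (by simpa using this)))
  have hne : x₀ + lo⁻¹ ≠ x₀ + hi⁻¹ := fun h' => h (inv_injective (add_left_cancel h'))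
  simp only [one_sub_mul_one_sub x₀ _ h1 h2]
  rcases (mul_ne_zero h1 h2).lt_or_gt with h3 | h3
  · convert isRealShape_mul_nonneg hne using 4 with v
    rw [mul_nonpos_iff_of_neg_left h3]
  · convert isRealShape_mul_nonpos hne using 4 with v
    rw [mul_nonpos_iff_of_pos_left h3]

lemma isRealShape_quadratic_nonneg (x₀ : ℝ) {lo hi : ℝ} (h : lo ≠ hi) :
    IsRealShape (Complex.ofReal '' {v : ℝ | 0 ≤ (1 - lo * (v - x₀)) * (1 - hi * (v - x₀))}) := by
  rcases eq_or_ne lo 0 with rfl | h1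
  · have := isRealRay_setOf_nonneg x₀ h.symm
    exact Or.inr (Or.inr (Or.inl (by simpa using this)))
  rcases eq_or_ne hi 0 with rfl | h2
  · have := isRealRay_setOf_nonneg x₀ h
    exact Or.inr (Or.inr (Or.inl (by simpa using this)))
  have hne : x₀ + lo⁻¹ ≠ x₀ + hi⁻¹ := fun h' => h (inv_injective (add_left_cancel h'))
  simp only [one_sub_mul_one_sub x₀ _ h1 h2]
  rcases (mul_ne_zero h1 h2).lt_or_gt with h3 | h3
  · convert isRealShape_mul_nonpos hne using 4 with v
    rw [mul_nonneg_iff_of_neg_left h3]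
  · convert isRealShape_mul_nonneg hne using 4 with v
    rw [mul_nonneg_iff_of_pos_left h3]

/-- The real points where `(1 - m x) ^ 2 ≤ q x ^ 2`, with `x` the displacement from `x₀`. -/
def realInner (x₀ m q : ℝ) : Set ℂ :=
  {z | z.im = 0 ∧ (1 - m * (z.re - x₀)) ^ 2 ≤ q * (z.re - x₀) ^ 2}

/-- The real points where `q x ^ 2 ≤ (1 - m x) ^ 2`, with `x` the displacement from `x₀`. -/
def realOuter (x₀ m q : ℝ) : Set ℂ :=
  {z | z.im = 0 ∧ q * (z.re - x₀) ^ 2 ≤ (1 - m * (z.re - x₀)) ^ 2}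

lemma sub_sqrt_ne_add_sqrt (m : ℝ) {q : ℝ} (hq : 0 < q) : m - √q ≠ m + √q := by
  have := Real.sqrt_pos.2 hq
  intro h
  linarith

lemma one_sub_sqrt_mul (m x : ℝ) {q : ℝ} (hq : 0 < q) :
    (1 - (m - √q) * x) * (1 - (m + √q) * x) = (1 - m * x) ^ 2 - q * x ^ 2 := by
  linear_combination -x ^ 2 * Real.sq_sqrt hq.le

lemma isRealShape_realInner (x₀ m : ℝ) {q : ℝ} (hq : 0 < q) :
    IsRealShape (realInner x₀ m q) := by
  have := isRealShape_quadratic_nonpos x₀ (sub_sqrt_ne_add_sqrt m hq)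
  rw [realInner]
  simpa only [one_sub_sqrt_mul m _ hq, sub_nonpos, image_ofReal_eq,
    Set.mem_ofPred_eq] using this

lemma isRealShape_realOuter (x₀ m : ℝ) {q : ℝ} (hq : 0 < q) :
    IsRealShape (realOuter x₀ m q) := by
  have := isRealShape_quadratic_nonneg x₀ (sub_sqrt_ne_add_sqrt m hq)
  rw [realOuter]
  simpa only [one_sub_sqrt_mul m _ hq, sub_nonneg, image_ofReal_eq,
    Set.mem_ofPred_eq] using this

/-! ### Circles, arcs and their vertical degenerations -/

lemma IsArc.symm {S : Set ℂ} {p q : ℂ} (h : IsArc S p q) : IsArc S q p := by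
  obtain ⟨o, R, θ₁, θ₂, h1, h2, h3, h4, h5⟩ := h
  exact ⟨o, R, θ₁, θ₂, h1, h2, h3, h4, h5.symm⟩

lemma circleMap_re (o : ℝ) (R θ : ℝ) : (circleMap o R θ).re = o + R * Real.cos θ := by
  simp [circleMap, Complex.exp_ofReal_mul_I_re]

lemma circleMap_im (o : ℝ) (R θ : ℝ) : (circleMap o R θ).im = R * Real.sin θ := by
  simp [circleMap, Complex.exp_ofReal_mul_I_im]

lemma exists_circleMap_eq {o R : ℝ} (hR : 0 < R) {z : ℂ}
    (hz : (z.re - o) ^ 2 + z.im ^ 2 = R ^ 2) :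
    ∃ θ ∈ Set.Ioc (-Real.pi) Real.pi, circleMap o R θ = z ∧ (0 < z.im → θ ∈ Set.Ioo 0 Real.pi) := by
  have hn : ‖z - o‖ = R := by
    rw [← sq_eq_sq₀ (norm_nonneg _) hR.le, ← Complex.normSq_eq_norm_sq, Complex.normSq_apply, ← hz]
    simp
    ring
  refine ⟨Complex.arg (z - o), Complex.arg_mem_Ioc _, ?_, fun him => ?_⟩
  · rw [circleMap, ← hn, Complex.norm_mul_exp_arg_mul_I]
    ring
  · have h1 : 0 < (z - o).im := by simpa using him
    refine ⟨lt_of_le_of_ne (Complex.arg_nonneg_iff.2 h1.le) fun h => ?_,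
      lt_of_le_of_ne (Complex.arg_le_pi _) fun h => ?_⟩
    · rw [eq_comm, Complex.arg_eq_zero_iff_zero_le, Complex.le_def] at h
      exact h1.ne h.2
    · exact h1.ne' (Complex.arg_eq_pi_iff.1 h).2

/-- The points of a circle centred on the real axis on one side of a vertical chord form an arc. -/
lemma isArc_of_re_le {o R : ℝ} (hR : 0 < R) {p : ℂ} (hp : (p.re - o) ^ 2 + p.im ^ 2 = R ^ 2)
    (him : 0 < p.im) :
    IsArc {z | (z.re - o) ^ 2 + z.im ^ 2 = R ^ 2 ∧ z.re ≤ p.re} p (⟨p.re, -p.im⟩ : ℂ) := by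
  obtain ⟨α, -, hα, hα'⟩ := exists_circleMap_eq hR hp
  obtain ⟨h0, hpi⟩ := hα' him
  have hre := circleMap_re o R α
  have himα := circleMap_im o R α
  rw [hα] at hre himα
  -- The left arc passes through angle `π`, so negative principal arguments are shifted by `2π`.
  refine ⟨o, R, α, 2 * Real.pi - α, hR, by linarith, by linarith, ?_, Or.inl ⟨hα, ?_⟩⟩
  · ext z
    constructor
    · rintro ⟨hz, hle⟩
      obtain ⟨θ, ⟨hθ1, hθ2⟩, rfl, -⟩ := exists_circleMap_eq hR hz
      rw [circleMap_re, hre] at hle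
      have hcos : Real.cos |θ| ≤ Real.cos α := by
        rw [Real.cos_abs]
        exact le_of_mul_le_mul_left (by linarith) hR
      have hge : α ≤ |θ| := by
        by_contra! h
        exact hcos.not_gt (Real.cos_lt_cos_of_nonneg_of_le_pi (abs_nonneg _) hpi.le h)
      rcases le_abs'.1 hge with h | h
      · refine ⟨θ + 2 * Real.pi, ⟨by linarith, by linarith⟩, periodic_circleMap _ _ _⟩
      · exact ⟨θ, ⟨h, by linarith⟩, rfl⟩
    · rintro ⟨θ, ⟨hθ1, hθ2⟩, rfl⟩
      simp only [Set.mem_ofPred_eq, circleMap_re, circleMap_im, hre]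
      refine ⟨by linear_combination R ^ 2 * Real.sin_sq_add_cos_sq θ, ?_⟩
      have : Real.cos θ ≤ Real.cos α := by
        rcases le_total θ Real.pi with h | h
        · exact Real.cos_le_cos_of_nonneg_of_le_pi h0.le h hθ1
        · rw [← Real.cos_two_pi_sub θ]
          exact Real.cos_le_cos_of_nonneg_of_le_pi h0.le (by linarith) (by linarith)
      gcongr
  · apply Complex.ext
    · rw [circleMap_re, Real.cos_two_pi_sub]
      exact hre.symm
    · rw [circleMap_im, Real.sin_two_pi_sub, himα]
      ring

lemma isArc_of_le_re {o R : ℝ} (hR : 0 < R) {p : ℂ} (hp : (p.re - o) ^ 2 + p.im ^ 2 = R ^ 2)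
    (him : 0 < p.im) :
    IsArc {z | (z.re - o) ^ 2 + z.im ^ 2 = R ^ 2 ∧ p.re ≤ z.re} p (⟨p.re, -p.im⟩ : ℂ) := by
  obtain ⟨α, -, hα, hα'⟩ := exists_circleMap_eq hR hp
  obtain ⟨h0, hpi⟩ := hα' him
  have hre := circleMap_re o R α
  have himα := circleMap_im o R α
  rw [hα] at hre himα
  refine ⟨o, R, -α, α, hR, by linarith, by linarith, ?_, Or.inr ⟨?_, hα⟩⟩
  · ext z
    constructor
    · rintro ⟨hz, hle⟩
      obtain ⟨θ, ⟨hθ1, hθ2⟩, rfl, -⟩ := exists_circleMap_eq hR hz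
      rw [circleMap_re, hre] at hle
      have hcos : Real.cos α ≤ Real.cos |θ| := by
        rw [Real.cos_abs]
        exact le_of_mul_le_mul_left (by linarith) hR
      have hge : |θ| ≤ α := by
        by_contra! h
        exact hcos.not_gt (Real.cos_lt_cos_of_nonneg_of_le_pi h0.le
          (abs_le.2 ⟨hθ1.le, hθ2⟩) h)
      exact ⟨θ, abs_le.1 hge, rfl⟩
    · rintro ⟨θ, hθ, rfl⟩
      simp only [Set.mem_ofPred_eq, circleMap_re, circleMap_im, hre]
      refine ⟨by linear_combination R ^ 2 * Real.sin_sq_add_cos_sq θ, ?_⟩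
      have : Real.cos α ≤ Real.cos θ := by
        rw [← Real.cos_abs θ]
        exact Real.cos_le_cos_of_nonneg_of_le_pi (abs_nonneg _) hpi.le (abs_le.2 hθ)
      gcongr
  · apply Complex.ext
    · rw [circleMap_re, Real.cos_neg]
      exact hre.symm
    · rw [circleMap_im, Real.sin_neg, himα]
      ring

/-- The circle `x = m (x ^ 2 + y ^ 2)`, a vertical line if `m = 0`, in coordinates centred at
`x₀`. -/
def pencilCircle (x₀ m : ℝ) : Set ℂ :=
  {z | z.re - x₀ = m * ((z.re - x₀) ^ 2 + z.im ^ 2)}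

lemma mem_pencilCircle_iff {x₀ m : ℝ} (hm : m ≠ 0) (z : ℂ) : z ∈ pencilCircle x₀ m ↔
    (z.re - (x₀ + 1 / (2 * m))) ^ 2 + z.im ^ 2 = (1 / (2 * |m|)) ^ 2 := by
  have h : (1 / (2 * |m|)) ^ 2 = 1 / (4 * m ^ 2) := by
    rw [div_pow, mul_pow, sq_abs]; norm_num
  have key : (z.re - (x₀ + 1 / (2 * m))) ^ 2 + z.im ^ 2 - 1 / (4 * m ^ 2) =
      -(1 / m) * (z.re - x₀ - m * ((z.re - x₀) ^ 2 + z.im ^ 2)) := by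
    field_simp
    ring
  have hm' : -(1 / m) ≠ 0 := neg_ne_zero.2 (one_div_ne_zero hm)
  rw [h, pencilCircle, Set.mem_ofPred_eq, ← sub_eq_zero, ← sub_eq_zero (b := 1 / (4 * m ^ 2)), key,
    mul_eq_zero_iff_left hm']

lemma isCircle_pencilCircle (x₀ : ℝ) {m : ℝ} (hm : m ≠ 0) : IsCircle (pencilCircle x₀ m) := by
  have hR : 0 < 1 / (2 * |m|) := by positivity
  refine ⟨((x₀ + 1 / (2 * m) : ℝ) : ℂ), _, hR, ?_⟩
  ext z
  rw [mem_pencilCircle_iff hm, mem_sphere_iff_norm, ← sq_eq_sq₀ (norm_nonneg _) hR.le,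
    ← Complex.normSq_eq_norm_sq, Complex.normSq_apply, Complex.sub_re, Complex.sub_im,
    Complex.ofReal_re, Complex.ofReal_im, sub_zero, ← sq, ← sq]

lemma pencilCircle_zero (x₀ : ℝ) : pencilCircle x₀ 0 = verticalLine x₀ := by
  ext z
  simp [pencilCircle, verticalLine, sub_eq_zero]

/-- The part of the circle at distance at most `K ^ (-1/2)` from `x₀`. -/
def nearArc (x₀ m K : ℝ) : Set ℂ :=
  {z | z ∈ pencilCircle x₀ m ∧ K * ((z.re - x₀) ^ 2 + z.im ^ 2) ≤ 1}

/-- The part of the circle at distance at least `K ^ (-1/2)` from `x₀`. -/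
def farArc (x₀ m K : ℝ) : Set ℂ :=
  {z | z ∈ pencilCircle x₀ m ∧ 1 ≤ K * ((z.re - x₀) ^ 2 + z.im ^ 2)}

/-- Its displacement from `x₀` is `1/(m - i r)`, whose inverse has real part `m`. -/
lemma arc_end_mem {x₀ m r K : ℝ} (hr : 0 < r) (hK : K = m ^ 2 + r ^ 2) :
    (⟨x₀ + m / K, r / K⟩ : ℂ) ∈ pencilCircle x₀ m := by
  have hK0 : 0 < K := by rw [hK]; positivity
  simp only [pencilCircle, Set.mem_ofPred_eq, add_sub_cancel_left]
  field_simp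
  rw [hK]

/-- On the circle the squared distance to `x₀` is proportional to `Re z - x₀`, so a distance bound
selects a side of a vertical chord; the sign of `m` tells which side. -/
lemma re_sub_of_mem_pencilCircle {x₀ m K : ℝ} (hK : K ≠ 0) {z : ℂ} (hz : z ∈ pencilCircle x₀ m) :
    z.re - (x₀ + m / K) = m / K * (K * ((z.re - x₀) ^ 2 + z.im ^ 2) - 1) := by
  rw [pencilCircle, Set.mem_ofPred_eq] at hz
  field_simp
  linear_combination K * hz

lemma isArc_nearArc (x₀ : ℝ) {m r K : ℝ} (hm : m ≠ 0) (hr : 0 < r) (hK : K = m ^ 2 + r ^ 2) :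
    IsArc (nearArc x₀ m K) ⟨x₀ + m / K, r / K⟩ ⟨x₀ + m / K, -(r / K)⟩ := by
  have hK0 : 0 < K := by rw [hK]; positivity
  have hR : 0 < 1 / (2 * |m|) := by positivity
  have hp := (mem_pencilCircle_iff hm _).1 (arc_end_mem (x₀ := x₀) hr hK)
  rcases hm.lt_or_gt with h | h
  · convert isArc_of_le_re hR hp (by dsimp; positivity) using 1
    ext z
    simp only [nearArc, Set.mem_ofPred_eq, ← mem_pencilCircle_iff hm]
    refine and_congr_right fun hz => ?_
    rw [← sub_nonneg (a := z.re), re_sub_of_mem_pencilCircle hK0.ne' hz,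
      mul_nonneg_iff_of_neg_left (div_neg_of_neg_of_pos h hK0), sub_nonpos]
  · convert isArc_of_re_le hR hp (by dsimp; positivity) using 1
    ext z
    simp only [nearArc, Set.mem_ofPred_eq, ← mem_pencilCircle_iff hm]
    refine and_congr_right fun hz => ?_
    rw [← sub_nonpos (a := z.re), re_sub_of_mem_pencilCircle hK0.ne' hz,
      mul_nonpos_iff_of_pos_left (div_pos h hK0), sub_nonpos]

lemma isArc_farArc (x₀ : ℝ) {m r K : ℝ} (hm : m ≠ 0) (hr : 0 < r) (hK : K = m ^ 2 + r ^ 2) :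
    IsArc (farArc x₀ m K) ⟨x₀ + m / K, r / K⟩ ⟨x₀ + m / K, -(r / K)⟩ := by
  have hK0 : 0 < K := by rw [hK]; positivity
  have hR : 0 < 1 / (2 * |m|) := by positivity
  have hp := (mem_pencilCircle_iff hm _).1 (arc_end_mem (x₀ := x₀) hr hK)
  rcases hm.lt_or_gt with h | h
  · convert isArc_of_re_le hR hp (by dsimp; positivity) using 1
    ext z
    simp only [farArc, Set.mem_ofPred_eq, ← mem_pencilCircle_iff hm]
    refine and_congr_right fun hz => ?_
    rw [← sub_nonpos (a := z.re), re_sub_of_mem_pencilCircle hK0.ne' hz,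
      mul_nonpos_iff_of_neg_left (div_neg_of_neg_of_pos h hK0), sub_nonneg]
  · convert isArc_of_le_re hR hp (by dsimp; positivity) using 1
    ext z
    simp only [farArc, Set.mem_ofPred_eq, ← mem_pencilCircle_iff hm]
    refine and_congr_right fun hz => ?_
    rw [← sub_nonneg (a := z.re), re_sub_of_mem_pencilCircle hK0.ne' hz,
      mul_nonneg_iff_of_pos_left (div_pos h hK0), sub_nonneg]

lemma pencilCircle_zero_bound_iff {r y : ℝ} (hr : 0 < r) :
    r ^ 2 * y ^ 2 ≤ 1 ↔ |y| ≤ r / r ^ 2 := by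
  rw [← mul_pow, sq_le_one_iff_abs_le_one, abs_mul, abs_of_pos hr, le_div_iff₀ (by positivity)]
  constructor <;> intro h <;> nlinarith

lemma segment_vertical (x h : ℝ) (hh : 0 < h) :
    segment ℝ (⟨x, -h⟩ : ℂ) ⟨x, h⟩ = {z | z.re = x ∧ |z.im| ≤ h} := by
  ext z
  rw [segment_eq_image', Set.mem_image, Set.mem_ofPred_eq]
  constructor
  · rintro ⟨t, ⟨h0, h1⟩, rfl⟩
    simp only [Complex.add_re, Complex.add_im, Complex.real_smul, Complex.re_ofReal_mul,
      Complex.im_ofReal_mul, Complex.sub_re, Complex.sub_im]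
    refine ⟨by ring, abs_le.2 ⟨by nlinarith, by nlinarith⟩⟩
  · rintro ⟨h1, h2⟩
    obtain ⟨h3, h4⟩ := abs_le.1 h2
    refine ⟨(z.im + h) / (2 * h), ⟨div_nonneg (by linarith) (by linarith), ?_⟩, ?_⟩
    · rw [div_le_one (by linarith)]; linarith
    · apply Complex.ext
      · simp only [Complex.add_re, Complex.smul_re, Complex.sub_re, sub_self, smul_zero, add_zero, h1]
      · simp only [Complex.add_im, Complex.real_smul, Complex.im_ofReal_mul, Complex.sub_im]
        field_simp
        ring

lemma isVerticalSegment_nearArc (x₀ : ℝ) {r : ℝ} (hr : 0 < r) :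
    IsVerticalSegment (nearArc x₀ 0 (r ^ 2)) ⟨x₀, -(r / r ^ 2)⟩ ⟨x₀, r / r ^ 2⟩ := by
  have h : 0 < r / r ^ 2 := by positivity
  refine ⟨rfl, fun heq => ?_, ?_⟩
  · have := congrArg Complex.im heq
    dsimp at this
    linarith
  · rw [segment_vertical _ _ h, nearArc, pencilCircle_zero]
    ext z
    simp only [verticalLine, Set.mem_ofPred_eq]
    refine and_congr_right fun hz => ?_
    rw [hz, sub_self, zero_pow two_ne_zero, zero_add, pencilCircle_zero_bound_iff hr]

lemma isTwoVerticalRays_farArc (x₀ : ℝ) {r : ℝ} (hr : 0 < r) :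
    IsTwoVerticalRays (farArc x₀ 0 (r ^ 2)) ⟨x₀, -(r / r ^ 2)⟩ ⟨x₀, r / r ^ 2⟩ := by
  have h : 0 < r / r ^ 2 := by positivity
  refine ⟨{z | z.re = x₀ ∧ z.im ≤ -(r / r ^ 2)}, {z | z.re = x₀ ∧ r / r ^ 2 ≤ z.im},
    Or.inr rfl, Or.inl rfl, ?_, ?_⟩
  · refine Set.disjoint_left.2 fun z h1 h2 => ?_
    simp only [Set.mem_ofPred_eq] at h1 h2
    linarith [h1.2, h2.2]
  · ext z
    simp only [farArc, pencilCircle_zero, verticalLine, Set.mem_ofPred_eq, Set.mem_union,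
      ← and_or_left]
    refine and_congr_right fun hz => ?_
    rw [hz, sub_self, zero_pow two_ne_zero, zero_add, ← le_abs', ← mul_pow, one_le_sq_iff_one_le_abs,
      abs_mul, abs_of_pos hr, div_le_iff₀ (by positivity)]
    constructor <;> intro h <;> nlinarith

/-! ### Inversion at the zero of `A` -/

/-- Multiplying by the square of the conjugate turns `1 - m p` into `(x - m |p|^2) - i y`. Vanishing
of the imaginary part of its square is the dichotomy between the circle and the real line. -/
lemma one_sub_mul_sq_eq_iff {p : ℂ} (hp : p ≠ 0) (m T : ℝ) :
    (1 - m * p) ^ 2 = T * p ^ 2 ↔ (p.re - m * (p.re ^ 2 + p.im ^ 2)) * p.im = 0 ∧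
      (p.re - m * (p.re ^ 2 + p.im ^ 2)) ^ 2 - p.im ^ 2 = T * (p.re ^ 2 + p.im ^ 2) ^ 2 := by
  set x := p.re with hx
  set y := p.im with hy
  set p' : ℂ := ⟨x, -y⟩ with hp'
  have hp'0 : p' ≠ 0 := by
    intro h
    apply hp
    have h1 := congrArg Complex.re h
    have h2 := congrArg Complex.im h
    apply Complex.ext
    · simpa [hp'] using h1
    · simpa [hp'] using h2
  have hmul : p * p' = ((x ^ 2 + y ^ 2 : ℝ) : ℂ) := by
    apply Complex.ext
    · simp only [hp', Complex.mul_re, Complex.ofReal_re, ← hx, ← hy]; ring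
    · simp only [hp', Complex.mul_im, Complex.ofReal_im, ← hx, ← hy]; ring
  have hlin : (1 - m * p) * p' = (⟨x - m * (x ^ 2 + y ^ 2), -y⟩ : ℂ) := by
    rw [sub_mul, mul_assoc, hmul]
    apply Complex.ext <;> simp [hp', -Complex.ofReal_add, -Complex.ofReal_pow]
  rw [← mul_left_inj' (pow_ne_zero 2 hp'0), ← mul_pow, mul_assoc, ← mul_pow, hlin, hmul,
    Complex.ext_iff]
  simp only [sq, Complex.mul_re, Complex.mul_im, ← Complex.ofReal_mul, Complex.ofReal_re,
    Complex.ofReal_im]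
  constructor
  · rintro ⟨h1, h2⟩
    exact ⟨by linarith, by linarith⟩
  · rintro ⟨h1, h2⟩
    exact ⟨by linarith, by linarith⟩

lemma eval_polyA (a b : ℝ) (z : ℂ) : (polyA a b).eval z = a * z + b := by simp [polyA]

lemma eval_polyB (c d e : ℝ) (z : ℂ) : (polyB c d e).eval z = c * z ^ 2 + d * z + e := by
  simp [polyB]

lemma mem_equimodularSet_iff {a b c d e x₀ E m q : ℝ} (ha : a ≠ 0) (hx₀ : x₀ = -b / a)
    (hE : E = c * x₀ ^ 2 + d * x₀ + e) (hE0 : E ≠ 0) (hm : m = -(2 * c * x₀ + d) / (2 * E))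
    (hq : q = m ^ 2 - (a ^ 2 + 4 * c) / (4 * E)) (z : ℂ) :
    z ∈ equimodularSet (polyA a b) (polyB c d e) ↔
      z = x₀ ∨ (z ≠ x₀ ∧ ∃ T : ℝ, 0 ≤ E * (q - T) ∧
        (1 - m * (z - x₀)) ^ 2 = T * (z - x₀) ^ 2) := by
  have haC : (a : ℂ) ≠ 0 := by exact_mod_cast ha
  have hEC : (E : ℂ) ≠ 0 := by exact_mod_cast hE0
  have hA : (polyA a b).eval z = a * (z - x₀) := by
    rw [eval_polyA, hx₀]; push_cast; field_simp; ring
  have hmC : (m : ℂ) * (2 * E) = -(2 * c * x₀ + d) := by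
    have : m * (2 * E) = -(2 * c * x₀ + d) := by rw [hm]; field_simp
    exact_mod_cast this
  have hqC : (q : ℂ) * (4 * E) = m ^ 2 * (4 * E) - (a ^ 2 + 4 * c) := by
    have : q * (4 * E) = m ^ 2 * (4 * E) - (a ^ 2 + 4 * c) := by rw [hq]; field_simp
    exact_mod_cast this
  have hEC' : (E : ℂ) = c * x₀ ^ 2 + d * x₀ + e := by exact_mod_cast hE
  have hB : (polyB c d e).eval z =
      E * ((1 - m * (z - x₀)) ^ 2 - q * (z - x₀) ^ 2) - a ^ 2 * (z - x₀) ^ 2 / 4 := by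
    rw [eval_polyB]
    linear_combination (z - x₀) * hmC + (z - x₀) ^ 2 / 4 * hqC - hEC'
  rw [equimodularSet, Set.mem_ofPred_eq, hA, hB]
  set p := z - x₀ with hp
  have hp0 : z = x₀ ↔ p = 0 := by rw [hp, sub_eq_zero]
  rw [hp0, ne_eq, hp0]
  constructor
  · rintro ⟨s, ⟨hs0, hs4⟩, hs⟩
    by_cases hpz : p = 0
    · exact Or.inl hpz
    refine Or.inr ⟨hpz, ?_⟩
    have hs0' : s ≠ 0 := by
      rintro rfl
      simp [ha, hpz] at hs
    have hspos : 0 < s := lt_of_le_of_ne hs0 hs0'.symm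
    have hsC : (s : ℂ) ≠ 0 := by exact_mod_cast hs0'
    -- Obtained by dividing `A^2 + s B = 0` by `s E`. The bound `s ≤ 4` becomes `E (q - T) ≥ 0`,
    -- while `s = 0` corresponds to `z = x₀`.
    refine ⟨q - a ^ 2 * (1 / s - 1 / 4) / E, ?_, ?_⟩
    · rw [sub_sub_cancel, mul_div_cancel₀ _ hE0]
      have : 1 / 4 ≤ 1 / s := one_div_le_one_div_of_le hspos hs4
      have := sub_nonneg.2 this
      positivity
    · push_cast
      field_simp
      linear_combination 4 * hs
  · rintro (hpz | ⟨hpz, T, hT, h⟩)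
    · exact ⟨0, by simp, by simp [hpz]⟩
    · have ha2 : 0 < a ^ 2 := by positivity
      have hden : 0 < a ^ 2 + 4 * (E * (q - T)) := by linarith
      refine ⟨4 * a ^ 2 / (a ^ 2 + 4 * (E * (q - T))), ⟨by positivity, ?_⟩, ?_⟩
      · rw [div_le_iff₀ hden]; linarith
      · have hdC : (a : ℂ) ^ 2 + 4 * (E * (q - T)) ≠ 0 := by exact_mod_cast hden.ne'
        have hnum : (E : ℂ) * (T * p ^ 2 - q * p ^ 2) - a ^ 2 * p ^ 2 / 4 =
            -(p ^ 2 / 4) * (a ^ 2 + 4 * (E * (q - T))) := by ring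
        rw [h, hnum]
        push_cast
        generalize (a : ℂ) ^ 2 + 4 * (E * (q - T)) = K at hdC
        field_simp
        ring

lemma eq_ofReal_iff (z : ℂ) (x₀ : ℝ) : z = x₀ ↔ z.re - x₀ = 0 ∧ z.im = 0 := by
  rw [Complex.ext_iff, sub_eq_zero]
  rfl

/-- The parameter `T` is eliminated separately on the circle and on the real line. The point `x₀` is
covered by the circle branch, hence its exclusion from the real one. -/
lemma mem_equimodularSet_iff_re_im {a b c d e x₀ E m q : ℝ} (ha : a ≠ 0) (hx₀ : x₀ = -b / a)
    (hE : E = c * x₀ ^ 2 + d * x₀ + e) (hE0 : E ≠ 0) (hm : m = -(2 * c * x₀ + d) / (2 * E))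
    (hq : q = m ^ 2 - (a ^ 2 + 4 * c) / (4 * E)) (z : ℂ) :
    z ∈ equimodularSet (polyA a b) (polyB c d e) ↔
      (z ∈ pencilCircle x₀ m ∧ 0 ≤ E * (q * ((z.re - x₀) ^ 2 + z.im ^ 2) ^ 2 + z.im ^ 2)) ∨
      (z.im = 0 ∧ 0 ≤ E * (q * (z.re - x₀) ^ 2 - (1 - m * (z.re - x₀)) ^ 2) ∧ z.re - x₀ ≠ 0) := by
  rw [mem_equimodularSet_iff ha hx₀ hE hE0 hm hq, pencilCircle, Set.mem_ofPred_eq]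
  by_cases hz : z = x₀
  · simp [hz]
  have hp : z - x₀ ≠ 0 := sub_ne_zero.2 hz
  have hN : 0 < (z.re - x₀) ^ 2 + z.im ^ 2 := by
    rw [eq_ofReal_iff, not_and_or] at hz
    rcases hz with h | h <;> positivity
  simp only [hz, false_or, ne_eq, not_false_eq_true, true_and, one_sub_mul_sq_eq_iff hp,
    Complex.sub_re, Complex.sub_im, Complex.ofReal_re, Complex.ofReal_im, sub_zero]
  set x := z.re - x₀ with hx
  set y := z.im
  set N := x ^ 2 + y ^ 2 with hNdef
  constructor
  · rintro ⟨T, hT, h1, h2⟩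
    rcases mul_eq_zero.1 h1 with h | h
    · left
      refine ⟨sub_eq_zero.1 h, ?_⟩
      rw [h] at h2
      have : E * (q * N ^ 2 + y ^ 2) = E * (q - T) * N ^ 2 := by linear_combination -E * h2
      rw [this]
      positivity
    · right
      have hx0 : x ≠ 0 := fun h' => by simp [hNdef, h, h'] at hN
      refine ⟨h, ?_, hx0⟩
      have h3 : (1 - m * x) ^ 2 = T * x ^ 2 := by
        apply mul_left_cancel₀ (pow_ne_zero 2 hx0)
        rw [hNdef, h] at h2
        linear_combination h2
      have : E * (q * x ^ 2 - (1 - m * x) ^ 2) = E * (q - T) * x ^ 2 := by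
        linear_combination -E * h3
      rw [this]
      positivity
  · rintro (⟨h1, h2⟩ | ⟨h1, h2, h3⟩)
    -- On the circle `1/p - m` is the imaginary number `-i y/N`, and `T` is its square.
    · refine ⟨-y ^ 2 / N ^ 2, ?_, ?_, ?_⟩
      · have : E * (q - -y ^ 2 / N ^ 2) = E * (q * N ^ 2 + y ^ 2) / N ^ 2 := by field_simp; ring
        rw [this]
        positivity
      · rw [← h1, sub_self, zero_mul]
      · rw [← h1]
        field_simp
        ring
    · have hNx : N = x ^ 2 := by rw [hNdef, h1]; ring
      refine ⟨(1 - m * x) ^ 2 / x ^ 2, ?_, ?_, ?_⟩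
      · have : E * (q - (1 - m * x) ^ 2 / x ^ 2) =
            E * (q * x ^ 2 - (1 - m * x) ^ 2) / x ^ 2 := by field_simp
        rw [this]
        positivity
      · rw [h1, mul_zero]
      · rw [hNx, h1]
        field_simp
        ring

/-- On the circle, the quadratic condition becomes a bound on the distance to `x₀`. -/
lemma quadratic_eq_of_mem_pencilCircle {x₀ m : ℝ} (q : ℝ) {z : ℂ} (hz : z ∈ pencilCircle x₀ m) :
    q * ((z.re - x₀) ^ 2 + z.im ^ 2) ^ 2 + z.im ^ 2 = ((z.re - x₀) ^ 2 + z.im ^ 2) *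
      (1 - (m ^ 2 - q) * ((z.re - x₀) ^ 2 + z.im ^ 2)) := by
  rw [pencilCircle, Set.mem_ofPred_eq] at hz
  linear_combination (-(z.re - x₀) - m * ((z.re - x₀) ^ 2 + z.im ^ 2)) * hz

/-! ### Shape of the set by the signs of `E` and `q` -/

lemma sq_sub_pos_of_neg {m q : ℝ} (hq0 : q < 0) : 0 < m ^ 2 - q := by linarith [sq_nonneg m]

/-- Here `T ≤ q < 0` leaves only imaginary `w = 1/p - m` with `|w|^2 ≥ -q`; as `1/|p|^2 = m^2 +
|w|^2`, this bounds the distance to `x₀` from above. -/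
lemma equimodularSet_eq_nearArc {a b c d e x₀ E m q : ℝ} (ha : a ≠ 0) (hx₀ : x₀ = -b / a)
    (hE : E = c * x₀ ^ 2 + d * x₀ + e) (hm : m = -(2 * c * x₀ + d) / (2 * E))
    (hq : q = m ^ 2 - (a ^ 2 + 4 * c) / (4 * E))
    (hE0 : 0 < E) (hq0 : q < 0) :
    equimodularSet (polyA a b) (polyB c d e) = nearArc x₀ m (m ^ 2 - q) := by
  have hK := sq_sub_pos_of_neg (m := m) hq0
  ext z
  rw [mem_equimodularSet_iff_re_im ha hx₀ hE hE0.ne' hm hq, nearArc, Set.mem_ofPred_eq]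
  have hN : 0 ≤ (z.re - x₀) ^ 2 + z.im ^ 2 := by positivity
  constructor
  · rintro (⟨h1, h2⟩ | ⟨-, h2, h3⟩)
    · refine ⟨h1, ?_⟩
      rw [quadratic_eq_of_mem_pencilCircle q h1, mul_nonneg_iff_of_pos_left hE0] at h2
      rcases hN.eq_or_lt with h | h
      · rw [← h]; simp
      · linarith [(mul_nonneg_iff_of_pos_left h).1 h2]
    · exfalso
      rw [mul_nonneg_iff_of_pos_left hE0] at h2
      have : 0 < (z.re - x₀) ^ 2 := by positivity
      nlinarith [sq_nonneg (1 - m * (z.re - x₀))]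
  · rintro ⟨h1, h2⟩
    refine Or.inl ⟨h1, ?_⟩
    rw [quadratic_eq_of_mem_pencilCircle q h1]
    exact mul_nonneg hE0.le (mul_nonneg hN (sub_nonneg.2 h2))

lemma equimodularSet_eq_pencilCircle_union {a b c d e x₀ E m q : ℝ} (ha : a ≠ 0) (hx₀ : x₀ = -b / a)
    (hE : E = c * x₀ ^ 2 + d * x₀ + e) (hm : m = -(2 * c * x₀ + d) / (2 * E))
    (hq : q = m ^ 2 - (a ^ 2 + 4 * c) / (4 * E))
    (hE0 : 0 < E) (hq0 : 0 ≤ q) :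
    equimodularSet (polyA a b) (polyB c d e) = pencilCircle x₀ m ∪ realInner x₀ m q := by
  ext z
  rw [mem_equimodularSet_iff_re_im ha hx₀ hE hE0.ne' hm hq, Set.mem_union, realInner,
    Set.mem_ofPred_eq, mul_nonneg_iff_of_pos_left hE0, mul_nonneg_iff_of_pos_left hE0, sub_nonneg,
    and_iff_left (show 0 ≤ q * ((z.re - x₀) ^ 2 + z.im ^ 2) ^ 2 + z.im ^ 2 by positivity)]
  refine or_congr_right (and_congr_right fun _ => and_iff_left_of_imp fun h1 h2 => ?_)
  rw [h2] at h1
  norm_num at h1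

lemma equimodularSet_eq_realOuter {a b c d e x₀ E m q : ℝ} (ha : a ≠ 0) (hx₀ : x₀ = -b / a)
    (hE : E = c * x₀ ^ 2 + d * x₀ + e) (hm : m = -(2 * c * x₀ + d) / (2 * E))
    (hq : q = m ^ 2 - (a ^ 2 + 4 * c) / (4 * E))
    (hE0 : E < 0) (hq0 : 0 < q) :
    equimodularSet (polyA a b) (polyB c d e) = realOuter x₀ m q := by
  ext z
  rw [mem_equimodularSet_iff_re_im ha hx₀ hE hE0.ne hm hq, realOuter, Set.mem_ofPred_eq,
    mul_nonneg_iff_of_neg_left hE0, mul_nonneg_iff_of_neg_left hE0, sub_nonpos]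
  constructor
  · rintro (⟨h1, h2⟩ | ⟨h1, h2, -⟩)
    · have h3 : z.im = 0 := by
        have := sq_nonneg ((z.re - x₀) ^ 2 + z.im ^ 2)
        exact pow_eq_zero_iff two_ne_zero |>.1 (le_antisymm (by nlinarith) (sq_nonneg _))
      rw [h3] at h2
      have h4 : z.re - x₀ = 0 := by
        by_contra h
        have : 0 < (z.re - x₀) ^ 2 := by positivity
        have : 0 < q * ((z.re - x₀) ^ 2 + 0 ^ 2) ^ 2 + 0 ^ 2 := by positivity
        linarith
      exact ⟨h3, by rw [h4]; norm_num⟩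
    · exact ⟨h1, h2⟩
  · rintro ⟨h1, h2⟩
    by_cases h : z.re - x₀ = 0
    · left
      simp [pencilCircle, h, h1]
    · exact Or.inr ⟨h1, h2, h⟩

lemma equimodularSet_eq_realLine {a b c d e x₀ E m q : ℝ} (ha : a ≠ 0) (hx₀ : x₀ = -b / a)
    (hE : E = c * x₀ ^ 2 + d * x₀ + e) (hm : m = -(2 * c * x₀ + d) / (2 * E))
    (hq : q = m ^ 2 - (a ^ 2 + 4 * c) / (4 * E))
    (hE0 : E < 0) (hq0 : q = 0) :
    equimodularSet (polyA a b) (polyB c d e) = realLine := by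
  ext z
  rw [mem_equimodularSet_iff_re_im ha hx₀ hE hE0.ne hm hq, realLine, Set.mem_ofPred_eq,
    mul_nonneg_iff_of_neg_left hE0, mul_nonneg_iff_of_neg_left hE0, hq0]
  constructor
  · rintro (⟨-, h2⟩ | ⟨h1, -, -⟩)
    · exact pow_eq_zero_iff two_ne_zero |>.1 (le_antisymm (by linarith) (sq_nonneg _))
    · exact h1
  · intro h1
    by_cases h : z.re - x₀ = 0
    · left
      simp [pencilCircle, h, h1]
    · exact Or.inr ⟨h1, by linarith [sq_nonneg (1 - m * (z.re - x₀))], h⟩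

/-- The condition `T ≥ q` with `q < 0` admits every real `w` and the imaginary `w` with `|w|^2 ≤
-q`, which keeps the arc away from `x₀`. -/
lemma equimodularSet_eq_realLine_union_farArc {a b c d e x₀ E m q : ℝ} (ha : a ≠ 0) (hx₀ : x₀ = -b / a)
    (hE : E = c * x₀ ^ 2 + d * x₀ + e) (hm : m = -(2 * c * x₀ + d) / (2 * E))
    (hq : q = m ^ 2 - (a ^ 2 + 4 * c) / (4 * E))
    (hE0 : E < 0) (hq0 : q < 0) :
    equimodularSet (polyA a b) (polyB c d e) = realLine ∪ farArc x₀ m (m ^ 2 - q) := by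
  ext z
  have hN : 0 ≤ (z.re - x₀) ^ 2 + z.im ^ 2 := by positivity
  rw [mem_equimodularSet_iff_re_im ha hx₀ hE hE0.ne hm hq, Set.mem_union, realLine, farArc,
    Set.mem_ofPred_eq, Set.mem_ofPred_eq,
    mul_nonneg_iff_of_neg_left hE0, mul_nonneg_iff_of_neg_left hE0]
  constructor
  · rintro (⟨h1, h2⟩ | ⟨h1, -, -⟩)
    · rw [quadratic_eq_of_mem_pencilCircle q h1] at h2
      rcases hN.eq_or_lt with h | h
      · left
        exact pow_eq_zero_iff two_ne_zero |>.1
          (le_antisymm (by linarith [sq_nonneg (z.re - x₀)]) (sq_nonneg _))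
      · right
        exact ⟨h1, by linarith [(mul_nonpos_iff_of_pos_left h).1 h2]⟩
    · exact Or.inl h1
  · rintro (h1 | ⟨h1, h2⟩)
    · by_cases h : z.re - x₀ = 0
      · left
        simp [pencilCircle, h, h1]
      · refine Or.inr ⟨h1, ?_, h⟩
        nlinarith [sq_nonneg (1 - m * (z.re - x₀)), sq_nonneg (z.re - x₀)]
    · left
      refine ⟨h1, ?_⟩
      rw [quadratic_eq_of_mem_pencilCircle q h1]
      exact mul_nonpos_of_nonneg_of_nonpos hN (sub_nonpos.2 h2)

/-! ### End points and intersections -/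

lemma discDelta_eq {a b c d e x₀ E m q : ℝ} (hx₀ : x₀ = -b / a)
    (hE : E = c * x₀ ^ 2 + d * x₀ + e) (hm : m = -(2 * c * x₀ + d) / (2 * E))
    (hq : q = m ^ 2 - (a ^ 2 + 4 * c) / (4 * E))
    (hE0 : E ≠ 0) : discDelta a b c d e = 64 * E ^ 2 * q := by
  have hmE : m * (2 * E) = -(2 * c * x₀ + d) := by rw [hm]; field_simp
  have hqE : q * (4 * E) = m ^ 2 * (4 * E) - (a ^ 2 + 4 * c) := by rw [hq]; field_simp
  rw [discDelta, ← hx₀]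
  linear_combination (-16 * E) * hqE + (-16) * (m * (2 * E) - (2 * c * x₀ + d)) * hmE +
    16 * (a ^ 2 + 4 * c) * hE

/-- For `q < 0` the identity `a^2 + 4c = 4E(m^2 - q)` excludes the degenerate branch of the
definitions. The absolute value there makes the plus sign the upper end whatever the sign of `E`. -/
lemma xDelta_eq {a b c d e x₀ E m q : ℝ} (ha : a ≠ 0) (hx₀ : x₀ = -b / a)
    (hE : E = c * x₀ ^ 2 + d * x₀ + e) (hm : m = -(2 * c * x₀ + d) / (2 * E))
    (hq : q = m ^ 2 - (a ^ 2 + 4 * c) / (4 * E))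
    (hE0 : E ≠ 0) (hq0 : q < 0) :
    xDeltaPlus a b c d e = ⟨x₀ + m / (m ^ 2 - q), √(-q) / (m ^ 2 - q)⟩ ∧
      xDeltaMinus a b c d e = ⟨x₀ + m / (m ^ 2 - q), -(√(-q) / (m ^ 2 - q))⟩ := by
  have hK := sq_sub_pos_of_neg (m := m) hq0
  set K := m ^ 2 - q with hKdef
  have hKE : a ^ 2 + 4 * c = 4 * E * K := by
    rw [hKdef, hq]; field_simp; ring
  have hne : a ^ 2 + 4 * c ≠ 0 := by rw [hKE]; positivity
  have hmE : m * (2 * E) = -(2 * c * x₀ + d) := by rw [hm]; field_simp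
  have hax : a * x₀ = -b := by rw [hx₀]; field_simp
  have hre : (-(a * b) - 2 * d) / (a ^ 2 + 4 * c) = x₀ + m / K := by
    rw [div_eq_iff hne]
    have : m / K * (a ^ 2 + 4 * c) = m * (2 * E) * 2 := by rw [hKE]; field_simp; ring
    rw [add_mul, this, hmE]
    linear_combination (-a) * hax
  have hsqrt : Complex.sqrt (discDelta a b c d e : ℂ) / ((2 * |a ^ 2 + 4 * c| : ℝ) : ℂ) =
      Complex.I * ((√(-q) / K : ℝ) : ℂ) := by
    have h1 : (discDelta a b c d e : ℂ) = -(((8 * |E|) ^ 2 * (-q) : ℝ) : ℂ) := by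
      rw [discDelta_eq hx₀ hE hm hq hE0, mul_pow, sq_abs]
      push_cast
      ring
    have h2 : (0 : ℝ) ≤ (8 * |E|) ^ 2 * (-q) := mul_nonneg (sq_nonneg _) (by linarith)
    have h3 : 2 * |a ^ 2 + 4 * c| = 8 * |E| * K := by
      rw [hKE, abs_mul, abs_mul, abs_of_pos hK]
      norm_num
      ring
    have hE1 : 0 < 8 * |E| := by positivity
    open ComplexOrder in
    have h2C : (0 : ℂ) ≤ (((8 * |E|) ^ 2 * (-q) : ℝ) : ℂ) := by exact_mod_cast h2
    rw [h1, h3, Complex.sqrt_neg_of_nonneg h2C, Complex.sqrt_of_nonneg h2C, Complex.ofReal_re,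
      Real.sqrt_mul (sq_nonneg _), Real.sqrt_sq hE1.le, mul_div_assoc, ← Complex.ofReal_div,
      mul_div_mul_left _ _ hE1.ne']
  rw [xDeltaPlus, xDeltaMinus, if_pos hne, if_pos hne, hsqrt, hre]
  constructor <;> apply Complex.ext <;> simp only [Complex.add_re, Complex.add_im, Complex.sub_re,
    Complex.sub_im, Complex.I_mul_re, Complex.I_mul_im, Complex.ofReal_re, Complex.ofReal_im] <;>
    ring

lemma verticalLine_inter_realInner (x₀ q : ℝ) : verticalLine x₀ ∩ realInner x₀ 0 q = ∅ := by
  rw [Set.eq_empty_iff_forall_notMem]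
  rintro z ⟨h1, -, h2⟩
  rw [verticalLine, Set.mem_ofPred_eq] at h1
  rw [h1] at h2
  norm_num at h2

/-- The circle meets the real axis at `x₀`, which violates the inequality, and at `x₀ + 1/m`, where
`1/p - m = 0`. For `m = 0` the latter point lies at infinity, hence the disjointness in the vertical
case. -/
lemma pencilCircle_inter_realInner (x₀ : ℝ) {m q : ℝ} (hm : m ≠ 0) (hq : 0 ≤ q) :
    pencilCircle x₀ m ∩ realInner x₀ m q = {((x₀ + 1 / m : ℝ) : ℂ)} := by
  ext z
  rw [Set.mem_inter_iff, pencilCircle, realInner, Set.mem_ofPred_eq, Set.mem_ofPred_eq,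
    Set.mem_singleton_iff, Complex.ext_iff, Complex.ofReal_re, Complex.ofReal_im]
  constructor
  · rintro ⟨h1, h2, h3⟩
    refine ⟨?_, h2⟩
    have hx : z.re - x₀ ≠ 0 := by
      intro h
      rw [h] at h3
      norm_num at h3
    rw [h2] at h1
    have : 1 = m * (z.re - x₀) := by
      apply mul_left_cancel₀ hx
      linear_combination h1
    field_simp
    linear_combination -this
  · rintro ⟨h1, h2⟩
    rw [h1, h2, add_sub_cancel_left]
    refine ⟨by field_simp; ring, rfl, ?_⟩
    rw [mul_one_div_cancel hm, sub_self, zero_pow two_ne_zero]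
    positivity

lemma realInner_zero_subset (x₀ m : ℝ) : realInner x₀ m 0 ⊆ pencilCircle x₀ m := by
  rintro z ⟨h1, h2⟩
  rw [zero_mul] at h2
  have h3 : 1 - m * (z.re - x₀) = 0 :=
    pow_eq_zero_iff two_ne_zero |>.1 (le_antisymm h2 (sq_nonneg _))
  rw [pencilCircle, Set.mem_ofPred_eq, h1]
  linear_combination (z.re - x₀) * h3

end RootDistribution

end

/-! ### The classification -/

open RootDistribution in
theorem mainTheorem3 (a b c d e : ℝ) (hac : a * c ≠ 0) (W : ℕ → ℂ[X])
    (hrec : RootDistribution.SatisfiesRec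
      (RootDistribution.polyA a b) (RootDistribution.polyB c d e) W)
    (hgen : RootDistribution.IsGeneral
      (RootDistribution.polyA a b) (RootDistribution.polyB c d e) W) :
    -- an arc with non-real ends, or a vertical segment with these ends
    ((RootDistribution.xDeltaMinus a b c d e).im ≠ 0 ∧
      (RootDistribution.xDeltaPlus a b c d e).im ≠ 0 ∧
      (RootDistribution.IsArc (RootDistribution.nonIsolatedLimits W)
          (RootDistribution.xDeltaMinus a b c d e) (RootDistribution.xDeltaPlus a b c d e) ∨
        RootDistribution.IsVerticalSegment (RootDistribution.nonIsolatedLimits W)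
          (RootDistribution.xDeltaMinus a b c d e) (RootDistribution.xDeltaPlus a b c d e))) ∨
    -- the real line with such an arc, or with two disjoint vertical rays with these ends
    ((RootDistribution.xDeltaMinus a b c d e).im ≠ 0 ∧
      (RootDistribution.xDeltaPlus a b c d e).im ≠ 0 ∧
      ∃ S : Set ℂ,
        (RootDistribution.IsArc S
            (RootDistribution.xDeltaMinus a b c d e) (RootDistribution.xDeltaPlus a b c d e) ∨
          RootDistribution.IsTwoVerticalRays S
            (RootDistribution.xDeltaMinus a b c d e) (RootDistribution.xDeltaPlus a b c d e)) ∧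
        RootDistribution.nonIsolatedLimits W = RootDistribution.realLine ∪ S) ∨
    -- the real line, a bounded real interval, a real ray, or two disjoint real rays
    RootDistribution.IsRealShape (RootDistribution.nonIsolatedLimits W) ∨
    -- a vertical line and a disjoint real shape
    (∃ (x : ℝ) (J : Set ℂ), RootDistribution.IsRealShape J ∧
      RootDistribution.verticalLine x ∩ J = ∅ ∧
      RootDistribution.nonIsolatedLimits W = RootDistribution.verticalLine x ∪ J) ∨
    -- a circle and a real shape meeting it in exactly one point
    (∃ K J : Set ℂ, RootDistribution.IsCircle K ∧ RootDistribution.IsRealShape J ∧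
      (∃ p : ℂ, K ∩ J = {p}) ∧
      RootDistribution.nonIsolatedLimits W = K ∪ J) ∨
    -- a circle, or a vertical line
    (RootDistribution.IsCircle (RootDistribution.nonIsolatedLimits W) ∨
      ∃ x : ℝ, RootDistribution.nonIsolatedLimits W = RootDistribution.verticalLine x) := by
  have ha : a ≠ 0 := left_ne_zero_of_mul hac
  have haC : (a : ℂ) ≠ 0 := by exact_mod_cast ha
  obtain ⟨x₀, hx₀⟩ : ∃ x₀, x₀ = -b / a := ⟨_, rfl⟩
  obtain ⟨E, hE⟩ : ∃ E, E = c * x₀ ^ 2 + d * x₀ + e := ⟨_, rfl⟩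
  obtain ⟨m, hm⟩ : ∃ m, m = -(2 * c * x₀ + d) / (2 * E) := ⟨_, rfl⟩
  obtain ⟨q, hq⟩ : ∃ q, q = m ^ 2 - (a ^ 2 + 4 * c) / (4 * E) := ⟨_, rfl⟩
  have hroot : (polyA a b).eval (x₀ : ℂ) = 0 := by
    rw [eval_polyA, hx₀]; push_cast; field_simp; ring
  have hA : polyA a b ≠ 0 := by
    intro h
    have h0 := eval_polyA a b 0
    have h1 := eval_polyA a b 1
    rw [h, eval_zero] at h0 h1
    exact haC (by linear_combination h0 - h1)
  -- `E` is the value of `B` at the only zero of `A`.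
  have hE0 : E ≠ 0 := by
    intro h
    refine hgen.no_common_zero_coeff ⟨x₀, hroot, ?_⟩
    rw [eval_polyB]
    exact_mod_cast hE.symm.trans h
  rw [nonIsolatedLimits_eq_equimodularSet hrec hgen hA ⟨_, hroot⟩]
  have hpencil : IsCircle (pencilCircle x₀ m) ∨ ∃ x, pencilCircle x₀ m = verticalLine x := by
    rcases eq_or_ne m 0 with rfl | hm0
    · exact Or.inr ⟨x₀, pencilCircle_zero x₀⟩
    · exact Or.inl (isCircle_pencilCircle x₀ hm0)
  rcases hE0.lt_or_gt with hE1 | hE1 <;> rcases lt_trichotomy q 0 with hq0 | hq0 | hq0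
  · right; left
    obtain ⟨hplus, hminus⟩ := xDelta_eq ha hx₀ hE hm hq hE0 hq0
    have hr : 0 < √(-q) := Real.sqrt_pos.2 (by linarith)
    have hK := sq_sub_pos_of_neg (m := m) hq0
    have hKr : m ^ 2 - q = m ^ 2 + √(-q) ^ 2 := by rw [Real.sq_sqrt (by linarith)]; ring
    rw [hplus, hminus, equimodularSet_eq_realLine_union_farArc ha hx₀ hE hm hq hE1 hq0]
    refine ⟨(neg_neg_of_pos (div_pos hr hK)).ne, (div_pos hr hK).ne', _, ?_, rfl⟩
    rcases eq_or_ne m 0 with rfl | hm0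
    · right
      rw [zero_pow two_ne_zero, zero_add] at hKr
      rw [zero_div, add_zero, zero_pow two_ne_zero, hKr]
      exact isTwoVerticalRays_farArc x₀ hr
    · exact Or.inl (isArc_farArc x₀ hm0 hr hKr).symm
  · exact Or.inr (Or.inr (Or.inl (Or.inl
      (equimodularSet_eq_realLine ha hx₀ hE hm hq hE1 hq0))))
  · rw [equimodularSet_eq_realOuter ha hx₀ hE hm hq hE1 hq0]
    exact Or.inr (Or.inr (Or.inl (isRealShape_realOuter x₀ m hq0)))
  · left
    obtain ⟨hplus, hminus⟩ := xDelta_eq ha hx₀ hE hm hq hE0 hq0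
    have hr : 0 < √(-q) := Real.sqrt_pos.2 (by linarith)
    have hK := sq_sub_pos_of_neg (m := m) hq0
    have hKr : m ^ 2 - q = m ^ 2 + √(-q) ^ 2 := by rw [Real.sq_sqrt (by linarith)]; ring
    rw [hplus, hminus, equimodularSet_eq_nearArc ha hx₀ hE hm hq hE1 hq0]
    refine ⟨(neg_neg_of_pos (div_pos hr hK)).ne, (div_pos hr hK).ne', ?_⟩
    rcases eq_or_ne m 0 with rfl | hm0
    · right
      rw [zero_pow two_ne_zero, zero_add] at hKr
      rw [zero_div, add_zero, zero_pow two_ne_zero, hKr]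
      exact isVerticalSegment_nearArc x₀ hr
    · exact Or.inl (isArc_nearArc x₀ hm0 hr hKr).symm
  -- For `q = 0` the real piece shrinks to at most one point, already on the circle.
  · rw [equimodularSet_eq_pencilCircle_union ha hx₀ hE hm hq hE1 hq0.ge, hq0,
      Set.union_eq_left.2 (realInner_zero_subset x₀ m)]
    exact Or.inr (Or.inr (Or.inr (Or.inr (Or.inr hpencil))))
  · rw [equimodularSet_eq_pencilCircle_union ha hx₀ hE hm hq hE1 hq0.le]
    right; right; right
    rcases eq_or_ne m 0 with rfl | hm0
    · rw [pencilCircle_zero]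
      exact Or.inl ⟨x₀, _, isRealShape_realInner x₀ 0 hq0, verticalLine_inter_realInner x₀ q, rfl⟩
    · exact Or.inr (Or.inl ⟨_, _, isCircle_pencilCircle x₀ hm0, isRealShape_realInner x₀ m hq0,
        ⟨_, pencilCircle_inter_realInner x₀ hm0 hq0.le⟩, rfl⟩)
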